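/- \textbf{Uniform bounds for the matrix Riccati equation.} Let $T>0$, let $A:[0,T]\to\mathbb R^{n_x\times n_x}$, $B:[0,T]\to\mathbb R^{n_x\times n_u}$, $Q:[0,T]\to\mathbb R^{n_x\times n_x}$, $H:[0,T]\to\mathbb R^{n_u\times n_x}$, $R:[0,T]\to\mathbb R^{n_u\times n_u}$ be matrix functions and let $Q_T\in\mathbb R^{n_x\times n_x}$. $\|\cdot\|$ is the operator norm induced by the Euclidean norms, and $M\preceq N$ means that $N-M$ is symmetric positive semidefinite. $\Phi_A(t,s)$ is the evolution operator of $\dot x=Ax$ (i.e. $\partial_t\Phi_A(t,s)=A(t)\Phi_A(t,s)$, $\Phi_A(s,s)=I$), and $$W_{A,B}(t_0,t_1)=\int_{t_0}^{t_1}\Phi_A(t_0,s)B(s)B(s)^\top\Phi_A(t_0,s)^\top\,ds .$$ Assume: \begin{enumerate} \item (Boundedness) $A,B,Q,H,R$ are continuous on $[0,T]$ and $\|A(t)\|\le\lambda_A$, $\|B(t)\|\le\lambda_B$, $\|Q(t)\|\le\lambda_Q$, $\|H(t)\|\le\lambda_H$, $\|R(t)\|\le\lambda_R$ for all $t\in[0,T]$,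 with constants $\lambda_A,\lambda_B,\lambda_Q,\lambda_H,\lambda_R>0$. \item (Uniform complete controllability) There are $\sigma\in(0,T)$ and constants $\alpha_0,\alpha_1,\beta_0,\beta_1>0$ such that for every $t_0\in[0,T-\sigma]$ there is $t_1\in[t_0,t_0+\sigma]$ with $$\alpha_0I\preceq W_{A,B}(t_0,t_1)\preceq\alpha_1I,\qquad \beta_0I\preceq\Phi_A(t_1,t_0)W_{A,B}(t_0,t_1)\Phi_A(t_1,t_0)^\top\preceq\beta_1I .$$ \item (Coercivity) There are $\gamma_R,\gamma_Q>0$ with $\gamma_Q\le\lambda_Q$ such that $R(t)\succeq\gamma_RI$ and $Q(t)-H(t)^\top R(t)^{-1}H(t)\succeq\gamma_QI$ for all $t\in[0,T]$, and $\gamma_QI\preceq Q_T\preceq\lambda_QI$. \end{enumerate} Then the matrix Riccati equation $$\dot S=SBR^{-1}B^\top S-S(A-BR^{-1}H)-(A-BR^{-1}H)^\top S-(Q-H^\top R^{-1}H)\ \text{ on }[0,T),\qquad S(T)=Q_T,$$ has exactly one solution $S:[0,T]\to\mathbb R^{n_x\times n_x}$ (continuous on $[0,T]$, differentiable on $[0,T)$),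 and $$c_0(\sigma)I\preceq S(t)\preceq c_1(\sigma)I\qquad\text{for all }t\in[0,T],$$ where $c_0(\sigma),c_1(\sigma)>0$ are the following constants, which do not depend on $T$. With $\mu=\lambda_A+\lambda_B\lambda_H/\gamma_R$, $$\tilde\alpha_0=\frac{1-e^{-2\mu\sigma}}{2\mu},\quad \tilde\alpha_1=\frac{e^{2\mu\sigma}-1}{2\mu},\quad \alpha_1'=\frac{\lambda_B^2(e^{2\mu\sigma}-1)}{2\mu},$$ $$\alpha_0'=\Big(\frac{2}{\alpha_0}+\frac{(\lambda_H/\gamma_R)^2}{\lambda_A}\Big(1+\frac{\alpha_1}{\alpha_0}\Big)^2(e^{2\lambda_A\sigma}-1)\Big)^{-1},$$ $$c_0(\sigma)=\min\Big\{2\mu\Big(\frac{\lambda_B^2}{\gamma_R}\Big(1+\frac{\tilde\alpha_1}{\tilde\alpha_0}\Big)^2+\frac{1}{\gamma_Q\tilde\alpha_0^2}\Big)^{-1},\ \Big(\frac{\lambda_B^2}{2\gamma_R\mu}+\frac1{\gamma_Q}\Big)^{-1}\Big\}e^{-2\mu\sigma},$$ $$c_1(\sigma)=\max\Big\{\Big(\Big(\lambda_Q+\frac{\lambda_H^2}{\gamma_R}\Big)\Big(1+\frac{\alpha_1'}{\alpha_0'}\Big)^2+\frac{\lambda_R\lambda_B^2}{(\alpha_0')^2}\Big)\frac1{2\mu},\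 \Big(\lambda_Q+\frac{\lambda_H^2}{\gamma_R}\Big)\Big(1+\frac1{2\mu}\Big)\Big\}e^{2\mu\sigma}.$$ -/

import Mathlib

open Set MeasureTheory
open scoped Matrix Matrix.Norms.L2Operator MatrixOrder

/- Throughout, `‖M‖` is the operator norm of a real matrix induced by the Euclidean norms, and
`M ≤ N` is the Loewner order, i.e. `N - M` is symmetric positive semidefinite. -/

/-- The terms of the Peano-Baker series of `ẋ = A x` started at time `s`. -/
noncomputable def peanoBakerTerm {n : ℕ} (A : ℝ → Matrix (Fin n) (Fin n) ℝ) (s : ℝ) :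
    ℕ → ℝ → Matrix (Fin n) (Fin n) ℝ
  | 0 => fun _ => 1
  | k + 1 => fun t => ∫ τ in s..t, A τ * peanoBakerTerm A s k τ

/-- The evolution operator `Φ_A(t, s)` of the homogeneous system `ẋ = A x`, constructed by the
Peano-Baker series. -/
noncomputable def evolutionOperator {n : ℕ} (A : ℝ → Matrix (Fin n) (Fin n) ℝ) (t s : ℝ) :
    Matrix (Fin n) (Fin n) ℝ :=
  ∑' k, peanoBakerTerm A s k t

theorem evolutionOperator_self {n : ℕ} (A : ℝ → Matrix (Fin n) (Fin n) ℝ) (s : ℝ) :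
    evolutionOperator A s s = 1 := by
  unfold evolutionOperator
  rw [tsum_eq_single 0]
  · simp [peanoBakerTerm]
  · intro k hk
    obtain ⟨j, rfl⟩ := Nat.exists_eq_succ_of_ne_zero hk
    simp [peanoBakerTerm]

theorem peanoBakerTerm_continuousOn {n : ℕ} {T : ℝ} {A : ℝ → Matrix (Fin n) (Fin n) ℝ}
    (hA : ContinuousOn A (Icc 0 T)) {s : ℝ} (hs : s ∈ Icc 0 T) (k : ℕ) :
    ContinuousOn (peanoBakerTerm A s k) (Icc 0 T) := by
  induction k with
  | zero => exact continuousOn_const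
  | succ k ih =>
    have hT : (0 : ℝ) ≤ T := hs.1.trans hs.2
    have h := intervalIntegral.continuousOn_primitive_interval' (a := s) (b₁ := 0) (b₂ := T)
      (f := fun τ => A τ * peanoBakerTerm A s k τ) (μ := volume)
      (ContinuousOn.intervalIntegrable (by rw [uIcc_of_le hT]; exact hA.mul ih))
      (by rw [uIcc_of_le hT]; exact hs)
    rw [uIcc_of_le hT] at h
    exact h

theorem peanoBakerTerm_norm_le {n : ℕ} {T K : ℝ} {A : ℝ → Matrix (Fin n) (Fin n) ℝ}
    (hK : ∀ t ∈ Icc 0 T, ‖A t‖ ≤ K) {s : ℝ} (hs : s ∈ Icc 0 T) (k : ℕ) :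
    ∀ t ∈ Icc 0 T, ‖peanoBakerTerm A s k t‖ ≤
      ‖(1 : Matrix (Fin n) (Fin n) ℝ)‖ * ((K * |t - s|) ^ k / (k.factorial : ℝ)) := by
  have hK0 : 0 ≤ K := (norm_nonneg _).trans (hK s hs)
  induction k with
  | zero => intro t _; simp [peanoBakerTerm]
  | succ k ih =>
    intro t ht
    set c := ‖(1 : Matrix (Fin n) (Fin n) ℝ)‖
    have hsub : uIcc s t ⊆ Icc 0 T := uIcc_subset_Icc hs ht
    have h1 : ‖∫ τ in s..t, A τ * peanoBakerTerm A s k τ‖ ≤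
        |∫ τ in s..t, K * (c * ((K * |τ - s|) ^ k / (k.factorial : ℝ)))| := by
      apply intervalIntegral.norm_integral_le_abs_of_norm_le
      · refine ae_restrict_of_forall_mem measurableSet_uIoc fun τ hτ => ?_
        have hτ' := hsub (uIoc_subset_uIcc hτ)
        exact (norm_mul_le _ _).trans
          (mul_le_mul (hK τ hτ') (ih τ hτ') (norm_nonneg _) hK0)
      · apply Continuous.intervalIntegrable
        fun_prop
    refine h1.trans (le_of_eq ?_)
    have h2 : ∀ τ : ℝ, K * (c * ((K * |τ - s|) ^ k / (k.factorial : ℝ))) =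
        (K ^ (k + 1) * c / (k.factorial : ℝ)) * |τ - s| ^ k := by
      intro τ; rw [mul_pow]; ring
    simp_rw [h2]
    rw [intervalIntegral.integral_const_mul, abs_mul]
    have h3 : |∫ τ in s..t, |τ - s| ^ k| = |t - s| ^ (k + 1) / (k + 1) := by
      rw [intervalIntegral.integral_comp_sub_right (fun x => |x| ^ k) s, sub_self]
      rcases le_total 0 (t - s) with h | h
      · have : ∫ x in (0 : ℝ)..(t - s), |x| ^ k = ∫ x in (0 : ℝ)..(t - s), x ^ k := by
          apply intervalIntegral.integral_congr
          intro x hx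
          rw [uIcc_of_le h] at hx
          simp [abs_of_nonneg hx.1]
        rw [this, integral_pow, abs_of_nonneg h]
        simp only [ne_eq, Nat.add_eq_zero_iff, one_ne_zero, and_false, not_false_eq_true,
          zero_pow, sub_zero]
        rw [abs_of_nonneg (by positivity)]
      · have : ∫ x in (0 : ℝ)..(t - s), |x| ^ k = ∫ x in (0 : ℝ)..(t - s), (-x) ^ k := by
          apply intervalIntegral.integral_congr
          intro x hx
          rw [uIcc_of_ge h] at hx
          simp [abs_of_nonpos hx.2]
        rw [this, intervalIntegral.integral_comp_neg (fun x => x ^ k), integral_pow,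
          abs_of_nonpos h]
        have h' : 0 ≤ -(t - s) := by linarith
        simp only [neg_zero, ne_eq, Nat.add_eq_zero_iff, one_ne_zero, and_false,
          not_false_eq_true, zero_pow, zero_sub, abs_neg, abs_div]
        rw [abs_of_nonneg (by positivity), abs_of_nonneg (by positivity)]
    rw [h3, abs_of_nonneg (by positivity), Nat.factorial_succ, mul_pow]
    push_cast
    field_simp

/-- The series indeed solves `∂ₜ Φ_A(t, s) = A(t) Φ_A(t, s)` on `[0, T]`. -/
theorem evolutionOperator_hasDerivWithinAt {n : ℕ} {T : ℝ}
    {A : ℝ → Matrix (Fin n) (Fin n) ℝ} (hA : ContinuousOn A (Icc 0 T))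
    {s t : ℝ} (hs : s ∈ Icc 0 T) (ht : t ∈ Icc 0 T) :
    HasDerivWithinAt (fun r => evolutionOperator A r s) (A t * evolutionOperator A t s)
      (Icc 0 T) t := by
  obtain ⟨K, hK⟩ := isCompact_Icc.exists_bound_of_continuousOn hA
  have hK0 : 0 ≤ K := (norm_nonneg _).trans (hK s hs)
  have hT : (0 : ℝ) ≤ T := hs.1.trans hs.2
  set c := ‖(1 : Matrix (Fin n) (Fin n) ℝ)‖
  let b : ℕ → ℝ := fun k => c * ((K * T) ^ k / (k.factorial : ℝ))
  have hb : Summable b := (Real.summable_pow_div_factorial (K * T)).mul_left c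
  have hle : ∀ k, ∀ r ∈ Icc 0 T, ‖peanoBakerTerm A s k r‖ ≤ b k := by
    intro k r hr
    refine (peanoBakerTerm_norm_le hK hs k r hr).trans ?_
    have : |r - s| ≤ T := by
      rw [abs_le]; constructor <;> linarith [hr.1, hr.2, hs.1, hs.2]
    have hc : 0 ≤ c := norm_nonneg _
    simp only [b]
    gcongr
  have hcont : ContinuousOn (fun r => evolutionOperator A r s) (Icc 0 T) :=
    continuousOn_tsum (fun k => peanoBakerTerm_continuousOn hA hs k) hb hle
  have hsum : ∀ r ∈ Icc 0 T, Summable fun k => peanoBakerTerm A s k r := fun r hr =>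
    Summable.of_norm_bounded hb fun k => hle k r hr
  have hint : ∀ r ∈ Icc 0 T, evolutionOperator A r s =
      1 + ∫ τ in s..r, A τ * evolutionOperator A τ s := by
    intro r hr
    have hsub : uIcc s r ⊆ Icc 0 T := uIcc_subset_Icc hs hr
    have key : HasSum (fun k => ∫ τ in s..r, A τ * peanoBakerTerm A s k τ)
        (∫ τ in s..r, A τ * evolutionOperator A τ s) := by
      apply intervalIntegral.hasSum_integral_of_dominated_convergence
        (bound := fun k _ => K * b k)
      · intro k
        exact ((hA.mul (peanoBakerTerm_continuousOn hA hs k)).mono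
          (uIoc_subset_uIcc.trans hsub)).aestronglyMeasurable measurableSet_uIoc
      · intro k
        refine Filter.Eventually.of_forall fun τ hτ => ?_
        have hτ' := hsub (uIoc_subset_uIcc hτ)
        exact (norm_mul_le _ _).trans
          (mul_le_mul (hK τ hτ') (hle k τ hτ') (norm_nonneg _) hK0)
      · exact Filter.Eventually.of_forall fun τ _ => hb.mul_left K
      · exact intervalIntegrable_const
      · refine Filter.Eventually.of_forall fun τ hτ => ?_
        have hτ' := hsub (uIoc_subset_uIcc hτ)
        exact (hsum τ hτ').hasSum.mul_left (A τ)
    rw [← key.tsum_eq]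
    exact (hsum r hr).tsum_eq_zero_add
  have hf : ContinuousOn (fun τ => A τ * evolutionOperator A τ s) (Icc 0 T) := hA.mul hcont
  have hd : HasDerivWithinAt (fun r => ∫ τ in s..r, A τ * evolutionOperator A τ s)
      (A t * evolutionOperator A t s) (Icc 0 T) t := by
    have : Fact (t ∈ Icc 0 T) := ⟨ht⟩
    apply intervalIntegral.integral_hasDerivWithinAt_right
    · exact (hf.mono (uIcc_subset_Icc hs ht)).intervalIntegrable
    · exact hf.stronglyMeasurableAtFilter_nhdsWithin measurableSet_Icc t
    · exact hf t ht
  exact (hd.const_add 1).congr (fun r hr => hint r hr) (hint t ht)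

/-- The controllability Gramian
`W_{A,B}(t₀, t₁) = ∫_{t₀}^{t₁} Φ_A(t₀, s) B(s) B(s)ᵀ Φ_A(t₀, s)ᵀ ds`. -/
noncomputable def gramian {n m : ℕ} (A : ℝ → Matrix (Fin n) (Fin n) ℝ)
    (B : ℝ → Matrix (Fin n) (Fin m) ℝ) (t₀ t₁ : ℝ) : Matrix (Fin n) (Fin n) ℝ :=
  ∫ s in t₀..t₁, evolutionOperator A t₀ s * B s * (B s)ᵀ * (evolutionOperator A t₀ s)ᵀ

/-- Continuity and uniform boundedness of the problem data on `[0, T]`. -/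
structure BoundedData {n m : ℕ} (T lamA lamB lamQ lamH lamR : ℝ)
    (A : ℝ → Matrix (Fin n) (Fin n) ℝ) (B : ℝ → Matrix (Fin n) (Fin m) ℝ)
    (Q : ℝ → Matrix (Fin n) (Fin n) ℝ) (H : ℝ → Matrix (Fin m) (Fin n) ℝ)
    (R : ℝ → Matrix (Fin m) (Fin m) ℝ) : Prop where
  lamA_pos : 0 < lamA
  lamB_pos : 0 < lamB
  lamQ_pos : 0 < lamQ
  lamH_pos : 0 < lamH
  lamR_pos : 0 < lamR
  continuousOn_A : ContinuousOn A (Icc 0 T)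
  continuousOn_B : ContinuousOn B (Icc 0 T)
  continuousOn_Q : ContinuousOn Q (Icc 0 T)
  continuousOn_H : ContinuousOn H (Icc 0 T)
  continuousOn_R : ContinuousOn R (Icc 0 T)
  norm_A_le : ∀ t ∈ Icc 0 T, ‖A t‖ ≤ lamA
  norm_B_le : ∀ t ∈ Icc 0 T, ‖B t‖ ≤ lamB
  norm_Q_le : ∀ t ∈ Icc 0 T, ‖Q t‖ ≤ lamQ
  norm_H_le : ∀ t ∈ Icc 0 T, ‖H t‖ ≤ lamH
  norm_R_le : ∀ t ∈ Icc 0 T, ‖R t‖ ≤ lamR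

/-- Uniform complete controllability of the pair `(A, B)` on `[0, T]`, with window length `σ`. -/
structure UniformlyCompletelyControllable {n m : ℕ} (T σ α₀ α₁ β₀ β₁ : ℝ)
    (A : ℝ → Matrix (Fin n) (Fin n) ℝ) (B : ℝ → Matrix (Fin n) (Fin m) ℝ) : Prop where
  σ_mem : σ ∈ Ioo 0 T
  α₀_pos : 0 < α₀
  α₁_pos : 0 < α₁
  β₀_pos : 0 < β₀
  β₁_pos : 0 < β₁
  bounds : ∀ t₀ ∈ Icc 0 (T - σ), ∃ t₁ ∈ Icc t₀ (t₀ + σ),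
    α₀ • (1 : Matrix (Fin n) (Fin n) ℝ) ≤ gramian A B t₀ t₁ ∧
    gramian A B t₀ t₁ ≤ α₁ • (1 : Matrix (Fin n) (Fin n) ℝ) ∧
    β₀ • (1 : Matrix (Fin n) (Fin n) ℝ) ≤
      evolutionOperator A t₁ t₀ * gramian A B t₀ t₁ * (evolutionOperator A t₁ t₀)ᵀ ∧
    evolutionOperator A t₁ t₀ * gramian A B t₀ t₁ * (evolutionOperator A t₁ t₀)ᵀ ≤
      β₁ • (1 : Matrix (Fin n) (Fin n) ℝ)

/-- Coercivity of the running and terminal costs. -/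
structure CoerciveCost {n m : ℕ} (T γR γQ lamQ : ℝ)
    (Q : ℝ → Matrix (Fin n) (Fin n) ℝ) (H : ℝ → Matrix (Fin m) (Fin n) ℝ)
    (R : ℝ → Matrix (Fin m) (Fin m) ℝ) (QT : Matrix (Fin n) (Fin n) ℝ) : Prop where
  γR_pos : 0 < γR
  γQ_pos : 0 < γQ
  γQ_le : γQ ≤ lamQ
  le_R : ∀ t ∈ Icc 0 T, γR • (1 : Matrix (Fin m) (Fin m) ℝ) ≤ R t
  le_Q : ∀ t ∈ Icc 0 T,
    γQ • (1 : Matrix (Fin n) (Fin n) ℝ) ≤ Q t - (H t)ᵀ * (R t)⁻¹ * H t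
  le_QT : γQ • (1 : Matrix (Fin n) (Fin n) ℝ) ≤ QT
  QT_le : QT ≤ lamQ • (1 : Matrix (Fin n) (Fin n) ℝ)

/-- `S` solves on `[0, T]` the matrix Riccati equation
`Ṡ = S B R⁻¹ Bᵀ S - S (A - B R⁻¹ H) - (A - B R⁻¹ H)ᵀ S - (Q - Hᵀ R⁻¹ H)`, `S(T) = Q_T`. -/
structure IsRiccatiSolution {n m : ℕ} (T : ℝ)
    (A : ℝ → Matrix (Fin n) (Fin n) ℝ) (B : ℝ → Matrix (Fin n) (Fin m) ℝ)
    (Q : ℝ → Matrix (Fin n) (Fin n) ℝ) (H : ℝ → Matrix (Fin m) (Fin n) ℝ)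
    (R : ℝ → Matrix (Fin m) (Fin m) ℝ) (QT : Matrix (Fin n) (Fin n) ℝ)
    (S : ℝ → Matrix (Fin n) (Fin n) ℝ) : Prop where
  continuousOn : ContinuousOn S (Icc 0 T)
  hasDeriv : ∀ t ∈ Ico 0 T, HasDerivWithinAt S
    (S t * B t * (R t)⁻¹ * (B t)ᵀ * S t
      - S t * (A t - B t * (R t)⁻¹ * H t)
      - (A t - B t * (R t)⁻¹ * H t)ᵀ * S t
      - (Q t - (H t)ᵀ * (R t)⁻¹ * H t)) (Icc 0 T) t
  terminal : S T = QT

/-- `μ = λ_A + λ_B λ_H / γ_R`. -/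
noncomputable def growthRate (lamA lamB lamH γR : ℝ) : ℝ := lamA + lamB * lamH / γR

/-- `α₀'(σ)`, with `λ_F = λ_H / γ_R`. -/
noncomputable def shiftedAlpha₀ (lamA lamH γR α₀ α₁ σ : ℝ) : ℝ :=
  (2 / α₀ + (lamH / γR) ^ 2 / lamA * (1 + α₁ / α₀) ^ 2 * (Real.exp (2 * lamA * σ) - 1))⁻¹

/-- `α₁'(σ)`, with `λ_F = λ_H / γ_R`. -/
noncomputable def shiftedAlpha₁ (lamA lamB lamH γR σ : ℝ) : ℝ :=
  lamB ^ 2 * (Real.exp (2 * σ * growthRate lamA lamB lamH γR) - 1) /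
    (2 * growthRate lamA lamB lamH γR)

/-- `α̃₀(σ)`. -/
noncomputable def dualAlpha₀ (lamA lamB lamH γR σ : ℝ) : ℝ :=
  1 / (2 * growthRate lamA lamB lamH γR) *
    (1 - Real.exp (-2 * growthRate lamA lamB lamH γR * σ))

/-- `α̃₁(σ)`. -/
noncomputable def dualAlpha₁ (lamA lamB lamH γR σ : ℝ) : ℝ :=
  1 / (2 * growthRate lamA lamB lamH γR) *
    (Real.exp (2 * growthRate lamA lamB lamH γR * σ) - 1)

/-- The lower constant `c₀(σ)`. -/
noncomputable def riccatiLower (lamA lamB lamH γR γQ σ : ℝ) : ℝ :=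
  min
    (2 * growthRate lamA lamB lamH γR *
      (lamB ^ 2 / γR *
          (1 + dualAlpha₁ lamA lamB lamH γR σ / dualAlpha₀ lamA lamB lamH γR σ) ^ 2
        + 1 / (γQ * dualAlpha₀ lamA lamB lamH γR σ ^ 2))⁻¹)
    (lamB ^ 2 / (2 * γR * growthRate lamA lamB lamH γR) + 1 / γQ)⁻¹
  * Real.exp (-2 * growthRate lamA lamB lamH γR * σ)

/-- The upper constant `c₁(σ)`. -/
noncomputable def riccatiUpper (lamA lamB lamQ lamH lamR γR α₀ α₁ σ : ℝ) : ℝ :=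
  max
    (((lamQ + lamH ^ 2 / γR) *
          (1 + shiftedAlpha₁ lamA lamB lamH γR σ / shiftedAlpha₀ lamA lamH γR α₀ α₁ σ) ^ 2
        + lamR * lamB ^ 2 / shiftedAlpha₀ lamA lamH γR α₀ α₁ σ ^ 2)
      * (1 / (2 * growthRate lamA lamB lamH γR)))
    ((lamQ + lamH ^ 2 / γR) * (1 + 1 / (2 * growthRate lamA lamB lamH γR)))
  * Real.exp (2 * growthRate lamA lamB lamH γR * σ)

/-! `Xᵀ S X` is the optimal cost of the linear-quadratic problem started at `X`: completing the
square bounds its derivative along any controlled motion by minus the running cost. Hence `S t` is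
at most the cost of any particular control. Far from `T` we use the control of least energy
steering the state to `0` over a controllability window; near `T` no control at all. The cross
term `H` is absorbed by the feedback `u = v - R⁻¹ H x`, which changes the Gramian of `(A, B)` only
by a bounded factor.

`S⁻¹` solves the Riccati equation of the dual problem, in which `-Fᵀ` replaces the drift `F` and
the state cost and the control weight are exchanged. Its control acts through the identity, so it
is controllable on every window, and the same two upper bounds applied to `S⁻¹` bound `S` from
below.

Existence comes from the linear Hamiltonian system: the derivative of `Xᵀ Y` along it is
nonpositive, so `Xᵀ Y` stays positive definite backwards from `T`, `X` stays invertible, and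
`S = Y X⁻¹`. -/

section LoewnerOrder

variable {ι κ : Type*}

theorem transpose_eq_of_nonneg {M : Matrix ι ι ℝ} (hM : 0 ≤ M) : Mᵀ = M := by
  simpa only [Matrix.conjTranspose_eq_transpose_of_trivial] using
    (Matrix.nonneg_iff_posSemidef.1 hM).isHermitian.eq

theorem posDef_of_smul_one_le [DecidableEq ι] {M : Matrix ι ι ℝ} {c : ℝ} (hc : 0 < c)
    (hM : c • 1 ≤ M) : M.PosDef := by
  simpa only [add_sub_cancel] using (Matrix.PosDef.one.smul hc).add_posSemidef (Matrix.le_iff.1 hM)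

theorem smul_one_le_smul_one [DecidableEq ι] {c d : ℝ} (h : c ≤ d) :
    c • (1 : Matrix ι ι ℝ) ≤ d • 1 := by
  rw [← sub_nonneg, ← sub_smul]
  exact (Matrix.PosSemidef.one.smul (sub_nonneg.2 h)).nonneg

variable [Fintype ι]

theorem transpose_mul_mul_nonneg [Finite κ] {M : Matrix ι ι ℝ} (hM : 0 ≤ M) (X : Matrix ι κ ℝ) :
    0 ≤ Xᵀ * M * X := by
  simpa only [Matrix.nonneg_iff_posSemidef, Matrix.conjTranspose_eq_transpose_of_trivial] using
    (Matrix.nonneg_iff_posSemidef.1 hM).conjTranspose_mul_mul_same X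

theorem transpose_mul_mul_mono [Finite κ] {M N : Matrix ι ι ℝ} (h : M ≤ N) (X : Matrix ι κ ℝ) :
    Xᵀ * M * X ≤ Xᵀ * N * X := by
  simpa only [Matrix.mul_sub, Matrix.sub_mul, sub_nonneg] using
    transpose_mul_mul_nonneg (sub_nonneg.2 h) X

theorem transpose_mul_self_nonneg [Finite κ] (X : Matrix ι κ ℝ) : 0 ≤ Xᵀ * X := by
  simpa only [Matrix.conjTranspose_eq_transpose_of_trivial] using
    (Matrix.posSemidef_conjTranspose_mul_self X).nonneg

theorem transpose_add_mul_add_le [Finite κ] (X Y : Matrix ι κ ℝ) :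
    (X + Y)ᵀ * (X + Y) ≤ (2 : ℝ) • (Xᵀ * X) + (2 : ℝ) • (Yᵀ * Y) := by
  have hparallelogram : (2 : ℝ) • (Xᵀ * X) + (2 : ℝ) • (Yᵀ * Y) - (X + Y)ᵀ * (X + Y) =
      (X - Y)ᵀ * (X - Y) := by
    simp only [Matrix.transpose_add, Matrix.transpose_sub, Matrix.add_mul, Matrix.mul_add,
      Matrix.sub_mul, Matrix.mul_sub, two_smul]
    abel
  exact sub_nonneg.1 (hparallelogram ▸ transpose_mul_self_nonneg (X - Y))

theorem norm_le_iff_le_smul_one [DecidableEq ι] {M : Matrix ι ι ℝ} {c : ℝ} (hM : 0 ≤ M)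
    (hc : 0 ≤ c) : ‖M‖ ≤ c ↔ M ≤ c • 1 := by
  have hsa : IsSelfAdjoint M := IsSelfAdjoint.of_nonneg hM
  rw [← Algebra.algebraMap_eq_smul_one, le_algebraMap_iff_spectrum_le hsa]
  conv_lhs => rw [← cfc_id ℝ M hsa, norm_cfc_le_iff id M hc]
  refine forall₂_congr fun x hx => ?_
  rw [id, Real.norm_of_nonneg (spectrum_nonneg_of_nonneg hM hx)]

variable [Fintype κ] [DecidableEq κ]

theorem transpose_mul_self_le_iff {X : Matrix ι κ ℝ} {c : ℝ} (hc : 0 ≤ c) :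
    Xᵀ * X ≤ c ^ 2 • 1 ↔ ‖X‖ ≤ c := by
  rw [← norm_le_iff_le_smul_one (transpose_mul_self_nonneg X) (sq_nonneg c),
    ← Matrix.conjTranspose_eq_transpose_of_trivial, Matrix.l2_opNorm_conjTranspose_mul_self,
    ← sq, sq_le_sq₀ (norm_nonneg X) hc]

variable [DecidableEq ι]

theorem norm_transpose (X : Matrix ι κ ℝ) : ‖Xᵀ‖ = ‖X‖ := by
  rw [← Matrix.conjTranspose_eq_transpose_of_trivial, Matrix.l2_opNorm_conjTranspose]

theorem mul_transpose_self_le {X : Matrix ι κ ℝ} {c : ℝ} (hc : 0 ≤ c) (hX : ‖X‖ ≤ c) :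
    X * Xᵀ ≤ c ^ 2 • 1 := by
  simpa only [Matrix.transpose_transpose] using
    (transpose_mul_self_le_iff hc).2 ((norm_transpose X).trans_le hX)

theorem norm_one_le : ‖(1 : Matrix ι ι ℝ)‖ ≤ 1 :=
  (norm_le_iff_le_smul_one Matrix.PosSemidef.one.nonneg zero_le_one).2 (one_smul ℝ _).ge

theorem transpose_mul_mul_le {M : Matrix ι ι ℝ} {X : Matrix ι κ ℝ} {a c : ℝ} (ha : 0 ≤ a)
    (hc : 0 ≤ c) (hM : M ≤ a • 1) (hX : ‖X‖ ≤ c) : Xᵀ * M * X ≤ (a * c ^ 2) • 1 :=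
  calc Xᵀ * M * X ≤ Xᵀ * (a • 1) * X := transpose_mul_mul_mono hM X
    _ = a • (Xᵀ * X) := by rw [Matrix.mul_smul, Matrix.smul_mul, Matrix.mul_one]
    _ ≤ a • (c ^ 2 • 1) := smul_le_smul_of_nonneg_left ((transpose_mul_self_le_iff hc).2 hX) ha
    _ = (a * c ^ 2) • 1 := smul_smul a _ _

theorem inv_le_iff_inv_le {M N : Matrix ι ι ℝ} (hM : M.PosDef) (hN : N.PosDef) :
    M⁻¹ ≤ N ↔ N⁻¹ ≤ M := by
  let := hM.isUnit.invertible
  let := hN.isUnit.invertible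
  simpa only [Matrix.conjTranspose_one, Matrix.one_mul, Matrix.mul_one, Matrix.le_iff] using
    (hM.fromBlocks₁₁ 1 N).symm.trans (hN.fromBlocks₂₂ M 1)

theorem inv_le_inv_smul_one {M : Matrix ι ι ℝ} {c : ℝ} (hc : 0 < c) (hM : c • 1 ≤ M) :
    M⁻¹ ≤ c⁻¹ • 1 := by
  rw [inv_le_iff_inv_le (posDef_of_smul_one_le hc hM) (Matrix.PosDef.one.smul (inv_pos.2 hc))]
  rwa [Matrix.inv_eq_right_inv (show c⁻¹ • (1 : Matrix ι ι ℝ) * c • 1 = 1 by simp [hc.ne'])]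

theorem norm_inv_le {M : Matrix ι ι ℝ} {c : ℝ} (hc : 0 < c) (hM : c • 1 ≤ M) :
    ‖M⁻¹‖ ≤ c⁻¹ :=
  (norm_le_iff_le_smul_one (posDef_of_smul_one_le hc hM).inv.posSemidef.nonneg
    (inv_nonneg.2 hc.le)).2 (inv_le_inv_smul_one hc hM)

end LoewnerOrder

section MatrixCalculus

variable {ι κ ν : Type*} {s : Set ℝ} {t : ℝ}

theorem hasDerivWithinAt_matrix_mul [Finite ι] [Fintype κ] [Finite ν] {X : ℝ → Matrix ι κ ℝ}
    {Y : ℝ → Matrix κ ν ℝ} {X' : Matrix ι κ ℝ} {Y' : Matrix κ ν ℝ}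
    (hX : HasDerivWithinAt X X' s t) (hY : HasDerivWithinAt Y Y' s t) :
    HasDerivWithinAt (fun r => X r * Y r) (X' * Y t + X t * Y') s t := by
  classical
  cases nonempty_fintype ι
  cases nonempty_fintype ν
  let mulBilin : Matrix ι κ ℝ →L[ℝ] Matrix κ ν ℝ →L[ℝ] Matrix ι ν ℝ :=
    LinearMap.mkContinuous₂
      (LinearMap.mk₂ ℝ (· * ·) Matrix.add_mul Matrix.smul_mul Matrix.mul_add
        fun c M N => Matrix.mul_smul M c N) 1
      fun M N => by simpa only [LinearMap.mk₂_apply, one_mul] using Matrix.l2_opNorm_mul M N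
  rw [add_comm]
  exact mulBilin.hasDerivWithinAt_of_bilinear hX hY

theorem hasDerivWithinAt_matrix_transpose [Finite ι] [Finite κ] {X : ℝ → Matrix ι κ ℝ}
    {X' : Matrix ι κ ℝ} (hX : HasDerivWithinAt X X' s t) :
    HasDerivWithinAt (fun r => (X r)ᵀ) X'ᵀ s t := by
  classical
  cases nonempty_fintype ι
  cases nonempty_fintype κ
  exact (Matrix.transposeLinearEquiv ι κ ℝ ℝ).toLinearMap.toContinuousLinearMap.hasFDerivAt
    |>.comp_hasDerivWithinAt t hX

theorem hasDerivWithinAt_matrix_inv [Fintype κ] [DecidableEq κ] {X : ℝ → Matrix κ κ ℝ}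
    {X' : Matrix κ κ ℝ} (hX : HasDerivWithinAt X X' s t) (hu : IsUnit (X t)) :
    HasDerivWithinAt (fun r => (X r)⁻¹) (-((X t)⁻¹ * X' * (X t)⁻¹)) s t := by
  obtain ⟨u, hu⟩ := hu
  have h := (hu ▸ hasFDerivAt_ringInverse u).comp_hasDerivWithinAt t hX
  simpa only [Function.comp_def, ← Matrix.nonsing_inv_eq_ringInverse, Matrix.coe_units_inv, hu,
    neg_apply, ContinuousLinearMap.mulLeftRight_apply] using h

theorem continuousOn_matrix_inv [Fintype κ] [DecidableEq κ] {X : ℝ → Matrix κ κ ℝ}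
    (hX : ContinuousOn X s) (hu : ∀ t ∈ s, IsUnit (X t)) : ContinuousOn (fun r => (X r)⁻¹) s := by
  simp only [Matrix.nonsing_inv_eq_ringInverse]
  intro t ht
  obtain ⟨u, hu⟩ := hu t ht
  exact (hu ▸ NormedRing.inverse_continuousAt u).comp_continuousWithinAt (hX t ht)

theorem eq_left_of_hasDerivWithinAt_zero {E : Type*} [NormedAddCommGroup E] [NormedSpace ℝ E]
    {f : ℝ → E} {a b : ℝ} (hf : ContinuousOn f (Icc a b))
    (hf' : ∀ r ∈ Ico a b, HasDerivWithinAt f 0 (Icc a b) r) {t : ℝ} (ht : t ∈ Icc a b) :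
    f t = f a :=
  constant_of_has_deriv_right_zero hf
    (fun r hr => (hf' r hr).mono_of_mem_nhdsWithin (Icc_mem_nhdsGE_of_mem hr)) t ht

theorem loewner_monotoneOn_of_deriv_nonneg [Finite κ] {f f' : ℝ → Matrix κ κ ℝ} {a b : ℝ}
    (hf : ∀ t ∈ Icc a b, HasDerivWithinAt f (f' t) (Icc a b) t)
    (hf' : ∀ t ∈ Icc a b, 0 ≤ f' t) : MonotoneOn f (Icc a b) := by
  classical
  cases nonempty_fintype κ
  have hcont : ContinuousOn f (Icc a b) := fun t ht => (hf t ht).continuousWithinAt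
  have hskew : ∀ t ∈ Icc a b, f t - (f t)ᵀ = f a - (f a)ᵀ := fun t ht =>
    eq_left_of_hasDerivWithinAt_zero (f := fun r => f r - (f r)ᵀ) (by fun_prop) (fun r hr => by
      have hr := Ico_subset_Icc_self hr
      simpa only [transpose_eq_of_nonneg (hf' r hr), sub_self] using!
        (hf r hr).sub (hasDerivWithinAt_matrix_transpose (hf r hr))) ht
  have hform : ∀ x : κ → ℝ, MonotoneOn (fun t => x ⬝ᵥ f t *ᵥ x) (Icc a b) := by
    intro x
    let quadForm : Matrix κ κ ℝ →ₗ[ℝ] ℝ :=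
      dotProductBilin ℝ ℝ x ∘ₗ (Matrix.mulVecBilin ℝ ℝ).flip x
    have hquad : ∀ t ∈ Icc a b,
        HasDerivWithinAt (fun t => x ⬝ᵥ f t *ᵥ x) (x ⬝ᵥ f' t *ᵥ x) (Icc a b) t := fun t ht =>
      quadForm.toContinuousLinearMap.hasFDerivAt.comp_hasDerivWithinAt t (hf t ht)
    refine monotoneOn_of_hasDerivWithinAt_nonneg (convex_Icc a b)
      (fun t ht => (hquad t ht).continuousWithinAt)
      (fun t ht => (hquad t (interior_subset ht)).mono interior_subset)
      fun t ht => (Matrix.nonneg_iff_posSemidef.1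
        (hf' t (interior_subset ht))).dotProduct_mulVec_nonneg x
  intro t ht r hr htr
  rw [Matrix.le_iff, Matrix.posSemidef_iff_dotProduct_mulVec]
  refine ⟨?_, fun x => ?_⟩
  · rw [Matrix.IsHermitian, Matrix.conjTranspose_eq_transpose_of_trivial, Matrix.transpose_sub]
    exact (sub_eq_sub_iff_sub_eq_sub.1 ((hskew r hr).trans (hskew t ht).symm)).symm
  · simpa only [star_trivial, Matrix.sub_mulVec, dotProduct_sub, sub_nonneg] using
      hform x ht hr htr

theorem loewner_sub_le_sub_of_deriv_le [Finite κ] {f f' g g' : ℝ → Matrix κ κ ℝ} {a b : ℝ}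
    (hab : a ≤ b)
    (hf : ∀ t ∈ Icc a b, HasDerivWithinAt f (f' t) (Icc a b) t)
    (hg : ∀ t ∈ Icc a b, HasDerivWithinAt g (g' t) (Icc a b) t)
    (h : ∀ t ∈ Icc a b, f' t ≤ g' t) : f b - f a ≤ g b - g a := by
  classical
  cases nonempty_fintype κ
  have hmono := loewner_monotoneOn_of_deriv_nonneg (fun t ht => (hg t ht).sub (hf t ht))
    (fun t ht => sub_nonneg.2 (h t ht)) (left_mem_Icc.2 hab) (right_mem_Icc.2 hab) hab
  rw [Pi.sub_apply, Pi.sub_apply, sub_le_sub_iff] at hmono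
  rwa [sub_le_sub_iff, add_comm (f b)]

end MatrixCalculus

/-- `∫₀ˢ exp (2 μ r) dr` in closed form, for `μ ≠ 0`: the energy accumulated in time `s` by motions
of growth rate `μ`. -/
noncomputable def growthIntegral (μ s : ℝ) : ℝ := (Real.exp (2 * μ * s) - 1) / (2 * μ)

section GrowthIntegral

variable {μ s t : ℝ}

theorem growthIntegral_zero (μ : ℝ) : growthIntegral μ 0 = 0 := by simp [growthIntegral]

theorem hasDerivAt_growthIntegral (hμ : μ ≠ 0) (s : ℝ) :
    HasDerivAt (growthIntegral μ) (Real.exp (2 * μ * s)) s := by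
  have h := (((hasDerivAt_id s).const_mul (2 * μ)).exp.sub_const 1).div_const (2 * μ)
  simp only [id, mul_one] at h
  rwa [mul_div_cancel_right₀ _ (by positivity)] at h

theorem growthIntegral_mono (hμ : 0 < μ) : Monotone (growthIntegral μ) := fun s t hst => by
  unfold growthIntegral
  gcongr

theorem growthIntegral_pos (hμ : 0 < μ) (hs : 0 < s) : 0 < growthIntegral μ s :=
  div_pos (sub_pos.2 (Real.one_lt_exp_iff.2 (by positivity))) (by positivity)

theorem growthIntegral_neg (μ s : ℝ) :
    growthIntegral (-μ) s = Real.exp (-(2 * μ * s)) * growthIntegral μ s := by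
  have h : Real.exp (-(2 * μ * s)) * Real.exp (2 * μ * s) = 1 := by
    rw [← Real.exp_add, neg_add_cancel, Real.exp_zero]
  rw [growthIntegral, growthIntegral, mul_neg, neg_mul, div_neg, ← neg_div, ← mul_div_assoc,
    mul_sub, h]
  ring

theorem growthIntegral_nonneg (hμ : 0 < μ) (hs : 0 ≤ s) : 0 ≤ growthIntegral μ s :=
  (growthIntegral_zero μ).symm.trans_le (growthIntegral_mono hμ hs)

theorem growthIntegral_le_exp (hμ : 0 < μ) (hst : s ≤ t) :
    growthIntegral μ s ≤ Real.exp (2 * μ * t) * (1 / (2 * μ)) :=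
  calc growthIntegral μ s ≤ growthIntegral μ t := growthIntegral_mono hμ hst
    _ ≤ Real.exp (2 * μ * t) / (2 * μ) := by unfold growthIntegral; gcongr; linarith
    _ = Real.exp (2 * μ * t) * (1 / (2 * μ)) := by rw [mul_one_div]

theorem exp_mul_sq (K s : ℝ) : Real.exp (K * s) ^ 2 = Real.exp (2 * K * s) := by
  rw [← Real.exp_nat_mul, Nat.cast_ofNat, mul_assoc]

end GrowthIntegral

section EvolutionOperator

variable {n : ℕ} {κ : Type*} {T K s t : ℝ}
  {A : ℝ → Matrix (Fin n) (Fin n) ℝ}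

theorem norm_le_exp_mul_norm_of_hasDerivWithinAt [Fintype κ] [DecidableEq κ]
    {A Z : ℝ → Matrix κ κ ℝ} (hst : s ≤ t) (hA : ∀ r ∈ Icc s t, ‖A r‖ ≤ K)
    (hZ : ∀ r ∈ Icc s t, HasDerivWithinAt Z (A r * Z r) (Icc s t) r) :
    ‖Z t‖ ≤ ‖Z s‖ * Real.exp (K * (t - s)) := by
  have h := norm_le_gronwallBound_of_norm_deriv_right_le (K := K) (ε := 0)
    (fun r hr => (hZ r hr).continuousWithinAt)
    (fun r hr => (hZ r (Ico_subset_Icc_self hr)).mono_of_mem_nhdsWithin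
      (Icc_mem_nhdsGE_of_mem hr)) le_rfl
    (fun r hr => by
      rw [add_zero]
      exact (norm_mul_le _ _).trans
        (mul_le_mul_of_nonneg_right (hA r (Ico_subset_Icc_self hr)) (norm_nonneg _)))
    t (right_mem_Icc.2 hst)
  rwa [gronwallBound_ε0] at h

/-- Pairing a trajectory with a trajectory of the adjoint system gives a conserved quantity. -/
theorem evolutionOperator_adjoint_transpose_mul [Finite κ] (hA : ContinuousOn A (Icc 0 T))
    {Z : ℝ → Matrix (Fin n) κ ℝ}
    (hZ : ∀ r ∈ Icc 0 T, HasDerivWithinAt Z (A r * Z r) (Icc 0 T) r)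
    (hs : s ∈ Icc 0 T) (ht : t ∈ Icc 0 T) :
    (evolutionOperator (fun r => -(A r)ᵀ) t s)ᵀ * Z t = Z s := by
  classical
  cases nonempty_fintype κ
  have hA' : ContinuousOn (fun r => -(A r)ᵀ) (Icc 0 T) := by fun_prop
  have hderiv : ∀ r ∈ Icc 0 T, HasDerivWithinAt
      (fun r => (evolutionOperator (fun r => -(A r)ᵀ) r s)ᵀ * Z r) 0 (Icc 0 T) r := by
    intro r hr
    refine (hasDerivWithinAt_matrix_mul (hasDerivWithinAt_matrix_transpose
      (evolutionOperator_hasDerivWithinAt hA' hs hr)) (hZ r hr)).congr_deriv ?_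
    simp only [Matrix.neg_mul, Matrix.transpose_neg, Matrix.transpose_mul,
      Matrix.transpose_transpose, Matrix.mul_assoc, neg_add_cancel]
  have hconst := fun {r} => eq_left_of_hasDerivWithinAt_zero (t := r)
    (fun r hr => (hderiv r hr).continuousWithinAt) fun r hr => hderiv r (Ico_subset_Icc_self hr)
  simpa only [evolutionOperator_self, Matrix.transpose_one, Matrix.one_mul] using
    (hconst ht).trans (hconst hs).symm

theorem evolutionOperator_adjoint_transpose_mul_evolutionOperator
    (hA : ContinuousOn A (Icc 0 T)) (hs : s ∈ Icc 0 T) (ht : t ∈ Icc 0 T) :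
    (evolutionOperator (fun r => -(A r)ᵀ) t s)ᵀ * evolutionOperator A t s = 1 := by
  rw [evolutionOperator_adjoint_transpose_mul hA
    (fun r hr => evolutionOperator_hasDerivWithinAt hA hs hr) hs ht, evolutionOperator_self]

theorem eq_evolutionOperator_mul [Finite κ] (hA : ContinuousOn A (Icc 0 T))
    {Z : ℝ → Matrix (Fin n) κ ℝ}
    (hZ : ∀ r ∈ Icc 0 T, HasDerivWithinAt Z (A r * Z r) (Icc 0 T) r)
    (hs : s ∈ Icc 0 T) (ht : t ∈ Icc 0 T) : Z t = evolutionOperator A t s * Z s := by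
  rw [← evolutionOperator_adjoint_transpose_mul hA hZ hs ht, ← Matrix.mul_assoc,
    mul_eq_one_comm.1 (evolutionOperator_adjoint_transpose_mul_evolutionOperator hA hs ht),
    Matrix.one_mul]

theorem evolutionOperator_mul_evolutionOperator (hA : ContinuousOn A (Icc 0 T))
    {r : ℝ} (hr : r ∈ Icc 0 T) (hs : s ∈ Icc 0 T) (ht : t ∈ Icc 0 T) :
    evolutionOperator A t s * evolutionOperator A s r = evolutionOperator A t r :=
  (eq_evolutionOperator_mul hA
    (fun _ hq => evolutionOperator_hasDerivWithinAt hA hr hq) hs ht).symm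

theorem evolutionOperator_mul_swap (hA : ContinuousOn A (Icc 0 T)) (hs : s ∈ Icc 0 T)
    (ht : t ∈ Icc 0 T) : evolutionOperator A t s * evolutionOperator A s t = 1 := by
  rw [evolutionOperator_mul_evolutionOperator hA ht hs ht, evolutionOperator_self]

theorem evolutionOperator_swap (hA : ContinuousOn A (Icc 0 T)) (hs : s ∈ Icc 0 T)
    (ht : t ∈ Icc 0 T) :
    evolutionOperator A s t = (evolutionOperator (fun r => -(A r)ᵀ) t s)ᵀ := by
  rw [← Matrix.one_mul (evolutionOperator A s t),
    ← evolutionOperator_adjoint_transpose_mul_evolutionOperator hA hs ht, Matrix.mul_assoc,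
    evolutionOperator_mul_swap hA hs ht, Matrix.mul_one]

theorem evolutionOperator_hasDerivWithinAt_right (hA : ContinuousOn A (Icc 0 T))
    (hs : s ∈ Icc 0 T) (ht : t ∈ Icc 0 T) :
    HasDerivWithinAt (evolutionOperator A s) (-(evolutionOperator A s t * A t)) (Icc 0 T) t := by
  have hA' : ContinuousOn (fun r => -(A r)ᵀ) (Icc 0 T) := by fun_prop
  refine ((hasDerivWithinAt_matrix_transpose (evolutionOperator_hasDerivWithinAt hA' hs ht)).congr
    (fun r hr => evolutionOperator_swap hA hs hr) (evolutionOperator_swap hA hs ht)).congr_deriv ?_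
  rw [evolutionOperator_swap hA hs ht, Matrix.neg_mul, Matrix.transpose_neg, Matrix.transpose_mul,
    Matrix.transpose_transpose]

theorem evolutionOperator_continuousOn_right (hA : ContinuousOn A (Icc 0 T))
    (hs : s ∈ Icc 0 T) : ContinuousOn (evolutionOperator A s) (Icc 0 T) := fun _ ht =>
  (evolutionOperator_hasDerivWithinAt_right hA hs ht).continuousWithinAt

theorem norm_evolutionOperator_le (hA : ContinuousOn A (Icc 0 T)) (hs : 0 ≤ s) (hst : s ≤ t)
    (ht : t ≤ T) (hK : ∀ r ∈ Icc s t, ‖A r‖ ≤ K) :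
    ‖evolutionOperator A t s‖ ≤ Real.exp (K * (t - s)) := by
  have h := norm_le_exp_mul_norm_of_hasDerivWithinAt (Z := (evolutionOperator A · s)) hst hK
    fun r hr => (evolutionOperator_hasDerivWithinAt hA ⟨hs, hst.trans ht⟩
      (Icc_subset_Icc hs ht hr)).mono (Icc_subset_Icc hs ht)
  rw [evolutionOperator_self] at h
  exact h.trans (mul_le_of_le_one_left (Real.exp_nonneg _) norm_one_le)

theorem norm_evolutionOperator_swap_le (hA : ContinuousOn A (Icc 0 T)) (hs : 0 ≤ s)
    (hst : s ≤ t) (ht : t ≤ T) (hK : ∀ r ∈ Icc s t, ‖A r‖ ≤ K) :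
    ‖evolutionOperator A s t‖ ≤ Real.exp (K * (t - s)) := by
  rw [evolutionOperator_swap hA ⟨hs, hst.trans ht⟩ ⟨hs.trans hst, ht⟩, norm_transpose]
  exact norm_evolutionOperator_le (by fun_prop) hs hst ht fun r hr => by
    rw [norm_neg, norm_transpose]; exact hK r hr

end EvolutionOperator

section Gramian

variable {n m : ℕ} {T K c a b s t : ℝ} {A : ℝ → Matrix (Fin n) (Fin n) ℝ}
  {B : ℝ → Matrix (Fin n) (Fin m) ℝ}

theorem gramian_self (A : ℝ → Matrix (Fin n) (Fin n) ℝ) (B : ℝ → Matrix (Fin n) (Fin m) ℝ)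
    (s : ℝ) : gramian A B s s = 0 :=
  intervalIntegral.integral_same

theorem gramian_hasDerivWithinAt (hA : ContinuousOn A (Icc 0 T)) (hB : ContinuousOn B (Icc 0 T))
    (hs : s ∈ Icc 0 T) (ht : t ∈ Icc 0 T) :
    HasDerivWithinAt (gramian A B s)
      (evolutionOperator A s t * B t * (evolutionOperator A s t * B t)ᵀ) (Icc 0 T) t := by
  have hf : ContinuousOn (fun r => evolutionOperator A s r * B r * (B r)ᵀ *
      (evolutionOperator A s r)ᵀ) (Icc 0 T) := by
    have hΦ := evolutionOperator_continuousOn_right hA hs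
    fun_prop
  have : Fact (t ∈ Icc 0 T) := ⟨ht⟩
  rw [Matrix.transpose_mul, ← Matrix.mul_assoc]
  exact intervalIntegral.integral_hasDerivWithinAt_right
    (hf.mono (uIcc_subset_Icc hs ht)).intervalIntegrable
    (hf.stronglyMeasurableAtFilter_nhdsWithin measurableSet_Icc t) (hf t ht)

theorem gramian_monotoneOn (hA : ContinuousOn A (Icc 0 T)) (hB : ContinuousOn B (Icc 0 T))
    (hs : s ∈ Icc 0 T) : MonotoneOn (gramian A B s) (Icc 0 T) :=
  loewner_monotoneOn_of_deriv_nonneg (fun _ ht => gramian_hasDerivWithinAt hA hB hs ht)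
    fun t _ => by
      simpa only [Matrix.transpose_transpose] using
        transpose_mul_self_nonneg (evolutionOperator A s t * B t)ᵀ

theorem gramian_nonneg (hA : ContinuousOn A (Icc 0 T)) (hB : ContinuousOn B (Icc 0 T))
    (hs : 0 ≤ s) (hst : s ≤ t) (ht : t ≤ T) : 0 ≤ gramian A B s t := by
  have hs' : s ∈ Icc 0 T := ⟨hs, hst.trans ht⟩
  simpa only [gramian_self] using gramian_monotoneOn hA hB hs' hs' ⟨hs.trans hst, ht⟩ hst

theorem gramian_le (hA : ContinuousOn A (Icc 0 T)) (hB : ContinuousOn B (Icc 0 T))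
    (ha : 0 ≤ a) (hab : a ≤ b) (hb : b ≤ T) (hK : 0 < K) (hAK : ∀ r ∈ Icc a b, ‖A r‖ ≤ K)
    (hBc : ∀ r ∈ Icc a b, ‖B r‖ ≤ c) :
    gramian A B a b ≤ (c ^ 2 * growthIntegral K (b - a)) • 1 := by
  have h := loewner_sub_le_sub_of_deriv_le (f := gramian A B a)
    (g := fun r => (c ^ 2 * growthIntegral K (r - a)) • 1) hab
    (fun r hr => (gramian_hasDerivWithinAt hA hB ⟨ha, hab.trans hb⟩
      (Icc_subset_Icc ha hb hr)).mono (Icc_subset_Icc ha hb))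
    (fun r _ => ((((hasDerivAt_growthIntegral hK.ne' (r - a)).comp_sub_const r a).const_mul
      (c ^ 2)).smul_const 1).hasDerivWithinAt) fun r hr => ?_
  · simpa only [gramian_self, sub_self, growthIntegral_zero, mul_zero, zero_smul, sub_zero] using h
  · have hc := (norm_nonneg _).trans (hBc r hr)
    have hΦ := norm_evolutionOperator_swap_le hA ha hr.1 (hr.2.trans hb)
      fun q hq => hAK q (Icc_subset_Icc_right hr.2 hq)
    have hnorm : ‖evolutionOperator A a r * B r‖ ≤ c * Real.exp (K * (r - a)) :=
      (Matrix.l2_opNorm_mul _ _).trans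
        (by rw [mul_comm]; exact mul_le_mul (hBc r hr) hΦ (norm_nonneg _) hc)
    simpa only [mul_pow, exp_mul_sq] using mul_transpose_self_le (by positivity) hnorm

theorem exp_neg_smul_one_le_evolutionOperator_mul_transpose (hA : ContinuousOn A (Icc 0 T))
    (hs : 0 ≤ s) (hst : s ≤ t) (ht : t ≤ T) (hK : ∀ r ∈ Icc s t, ‖A r‖ ≤ K) :
    Real.exp (-(2 * K * (t - s))) • 1 ≤
      evolutionOperator A s t * (evolutionOperator A s t)ᵀ := by
  have hinv := evolutionOperator_mul_swap hA (s := t) (t := s) ⟨hs.trans hst, ht⟩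
    ⟨hs, hst.trans ht⟩
  have hconj := transpose_mul_mul_mono (mul_transpose_self_le (Real.exp_nonneg _)
    (norm_evolutionOperator_le hA hs hst ht hK)) (evolutionOperator A s t)ᵀ
  rw [Matrix.transpose_transpose, ← Matrix.mul_assoc, hinv, Matrix.one_mul,
    ← Matrix.transpose_mul, hinv, Matrix.transpose_one, Matrix.mul_smul, Matrix.mul_one,
    Matrix.smul_mul, exp_mul_sq] at hconj
  rwa [Real.exp_neg, inv_smul_le_iff_of_pos (Real.exp_pos _)]

theorem le_gramian_one (hA : ContinuousOn A (Icc 0 T)) (ha : 0 ≤ a) (hab : a ≤ b) (hb : b ≤ T)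
    (hK : 0 < K) (hAK : ∀ r ∈ Icc a b, ‖A r‖ ≤ K) :
    growthIntegral (-K) (b - a) • 1 ≤ gramian A (fun _ => (1 : Matrix (Fin n) (Fin n) ℝ)) a b := by
  have h := loewner_sub_le_sub_of_deriv_le
    (f := fun r => growthIntegral (-K) (r - a) • 1)
    (g := gramian A (fun _ => (1 : Matrix (Fin n) (Fin n) ℝ)) a) hab
    (fun r _ => (((hasDerivAt_growthIntegral (neg_ne_zero.2 hK.ne') (r - a)).comp_sub_const
      r a).smul_const 1).hasDerivWithinAt)
    (fun r hr => (gramian_hasDerivWithinAt hA continuousOn_const ⟨ha, hab.trans hb⟩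
      (Icc_subset_Icc ha hb hr)).mono (Icc_subset_Icc ha hb)) fun r hr => ?_
  · simpa only [gramian_self, sub_self, growthIntegral_zero, zero_smul, sub_zero] using h
  · rw [Matrix.mul_one, mul_neg, neg_mul]
    exact exp_neg_smul_one_le_evolutionOperator_mul_transpose hA ha hr.1 (hr.2.trans hb)
      fun q hq => hAK q (Icc_subset_Icc_right hr.2 hq)

end Gramian

/-- The control `U` steers the system `ẋ = A x + B u` to the origin over `[a, b]`, from every
initial state at once: the motion started at `x₀` is `X r *ᵥ x₀`, driven by `U r *ᵥ x₀`. -/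
structure IsSteering {ι κ : Type*} [Fintype ι] [DecidableEq ι] [Fintype κ] (A : ℝ → Matrix ι ι ℝ)
    (B : ℝ → Matrix ι κ ℝ) (X : ℝ → Matrix ι ι ℝ) (U : ℝ → Matrix κ ι ℝ) (a b : ℝ) : Prop where
  hasDerivWithinAt : ∀ r ∈ Icc a b, HasDerivWithinAt X (A r * X r + B r * U r) (Icc a b) r
  initial : X a = 1
  terminal : X b = 0

namespace IsSteering

theorem feedback {ι κ : Type*} [Fintype ι] [DecidableEq ι] [Fintype κ] {a b : ℝ}
    {A X : ℝ → Matrix ι ι ℝ} {B : ℝ → Matrix ι κ ℝ} {U : ℝ → Matrix κ ι ℝ}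
    (h : IsSteering A B X U a b) (L : ℝ → Matrix κ ι ℝ) :
    IsSteering (fun r => A r - B r * L r) B X (fun r => U r + L r * X r) a b where
  hasDerivWithinAt r hr := (h.hasDerivWithinAt r hr).congr_deriv <| by
    rw [Matrix.sub_mul, Matrix.mul_add, Matrix.mul_assoc, sub_add_add_cancel]
  initial := h.initial
  terminal := h.terminal

/-- Expand `0 ≤ ∫ (V + e B* Φ*)ᵀ (V + e B* Φ*)`, in which the mixed terms are `-e` because the
derivative of `r ↦ Φ(a, r) X(r)` is `Φ(a, r) B(r) V(r)`. -/
theorem inv_smul_one_le_gramian {n m : ℕ} {T a b e : ℝ} {F X : ℝ → Matrix (Fin n) (Fin n) ℝ}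
    {B : ℝ → Matrix (Fin n) (Fin m) ℝ} {V : ℝ → Matrix (Fin m) (Fin n) ℝ}
    {J J' : ℝ → Matrix (Fin n) (Fin n) ℝ} (h : IsSteering F B X V a b)
    (hF : ContinuousOn F (Icc 0 T)) (hB : ContinuousOn B (Icc 0 T))
    (ha : 0 ≤ a) (hab : a ≤ b) (hb : b ≤ T) (he : 0 < e)
    (hJ : ∀ r ∈ Icc a b, HasDerivWithinAt J (J' r) (Icc a b) r)
    (hVJ : ∀ r ∈ Icc a b, (V r)ᵀ * V r ≤ J' r) (hJe : J b - J a ≤ e • 1) :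
    e⁻¹ • 1 ≤ gramian F B a b := by
  have hsub := Icc_subset_Icc ha hb
  have ha' : a ∈ Icc 0 T := ⟨ha, hab.trans hb⟩
  let Y : ℝ → Matrix (Fin n) (Fin m) ℝ := fun r => evolutionOperator F a r * B r
  let P : ℝ → Matrix (Fin n) (Fin n) ℝ := fun r => evolutionOperator F a r * X r
  have hP : ∀ r ∈ Icc a b, HasDerivWithinAt P (Y r * V r) (Icc a b) r := fun r hr => by
    refine (hasDerivWithinAt_matrix_mul ((evolutionOperator_hasDerivWithinAt_right hF ha'
      (hsub hr)).mono hsub) (h.hasDerivWithinAt r hr)).congr_deriv ?_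
    simp only [Y, Matrix.mul_add, Matrix.neg_mul, Matrix.mul_assoc, neg_add_cancel_left]
  have hW : ∀ r ∈ Icc a b, HasDerivWithinAt (gramian F B a) (Y r * (Y r)ᵀ) (Icc a b) r :=
    fun r hr => (gramian_hasDerivWithinAt hF hB ha' (hsub hr)).mono hsub
  have hsquare := loewner_monotoneOn_of_deriv_nonneg
    (fun r hr => (((hJ r hr).add ((hP r hr).const_smul e)).add
      ((hasDerivWithinAt_matrix_transpose (hP r hr)).const_smul e)).add
      ((hW r hr).const_smul (e ^ 2))) (fun r hr => ?_)
    (left_mem_Icc.2 hab) (right_mem_Icc.2 hab) hab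
  · have hPa : P a = 1 := by simp only [P, evolutionOperator_self, h.initial, Matrix.mul_one]
    have hPb : P b = 0 := by simp only [P, h.terminal, Matrix.mul_zero]
    simp only [Pi.add_apply, Pi.smul_apply, hPa, hPb, gramian_self, Matrix.transpose_one,
      Matrix.transpose_zero, smul_zero, add_zero] at hsquare
    have hW_ge : e • (1 : Matrix (Fin n) (Fin n) ℝ) ≤ e ^ 2 • gramian F B a b := by
      calc e • (1 : Matrix (Fin n) (Fin n) ℝ) = J a + e • 1 + e • 1 - J a - e • 1 := by abel
        _ ≤ J b + e ^ 2 • gramian F B a b - J a - e • 1 := by gcongr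
        _ = e ^ 2 • gramian F B a b + (J b - J a - e • 1) := by abel
        _ ≤ e ^ 2 • gramian F B a b := add_le_of_nonpos_right (sub_nonpos.2 hJe)
    rwa [sq, mul_smul, smul_le_smul_iff_of_pos_left he, ← inv_smul_le_iff_of_pos he] at hW_ge
  · calc (0 : Matrix (Fin n) (Fin n) ℝ)
        ≤ (V r + e • (Y r)ᵀ)ᵀ * (V r + e • (Y r)ᵀ) := transpose_mul_self_nonneg _
      _ = (V r)ᵀ * V r + e • (Y r * V r) + e • (Y r * V r)ᵀ + e ^ 2 • (Y r * (Y r)ᵀ) := by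
        simp only [Matrix.transpose_add, Matrix.transpose_smul, Matrix.transpose_transpose,
          Matrix.add_mul, Matrix.mul_add, Matrix.smul_mul, Matrix.mul_smul, Matrix.transpose_mul,
          smul_add, smul_smul, sq]
        abel
      _ ≤ J' r + e • (Y r * V r) + e • (Y r * V r)ᵀ + e ^ 2 • (Y r * (Y r)ᵀ) := by
        gcongr; exact hVJ r hr

end IsSteering

/-- The control of least energy `∫ₐᵇ |u|²` steering `ẋ = A x + B u` to the origin over `[a, b]`. -/
noncomputable def minEnergyControl {n m : ℕ} (A : ℝ → Matrix (Fin n) (Fin n) ℝ)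
    (B : ℝ → Matrix (Fin n) (Fin m) ℝ) (a b r : ℝ) : Matrix (Fin m) (Fin n) ℝ :=
  -((evolutionOperator A a r * B r)ᵀ * (gramian A B a b)⁻¹)

/-- The motion of `ẋ = A x + B u` driven by `minEnergyControl A B a b`. -/
noncomputable def minEnergyState {n m : ℕ} (A : ℝ → Matrix (Fin n) (Fin n) ℝ)
    (B : ℝ → Matrix (Fin n) (Fin m) ℝ) (a b r : ℝ) : Matrix (Fin n) (Fin n) ℝ :=
  evolutionOperator A r a * (1 - gramian A B a r * (gramian A B a b)⁻¹)

section MinEnergy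

variable {n m : ℕ} {T K c a b t α₀ α₁ : ℝ} {A : ℝ → Matrix (Fin n) (Fin n) ℝ}
  {B : ℝ → Matrix (Fin n) (Fin m) ℝ}

theorem isSteering_minEnergy (hA : ContinuousOn A (Icc 0 T)) (hB : ContinuousOn B (Icc 0 T))
    (ha : 0 ≤ a) (hab : a ≤ b) (hb : b ≤ T) (hW : IsUnit (gramian A B a b)) :
    IsSteering A B (minEnergyState A B a b) (minEnergyControl A B a b) a b where
  hasDerivWithinAt r hr := by
    have hsub := Icc_subset_Icc ha hb
    have ha' : a ∈ Icc 0 T := ⟨ha, hab.trans hb⟩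
    refine ((hasDerivWithinAt_matrix_mul (evolutionOperator_hasDerivWithinAt hA ha' (hsub hr))
      ((hasDerivWithinAt_matrix_mul (gramian_hasDerivWithinAt hA hB ha' (hsub hr))
        (hasDerivWithinAt_const r _ _)).const_sub 1)).mono hsub).congr_deriv ?_
    simp only [minEnergyState, minEnergyControl, Matrix.mul_zero, add_zero, Matrix.mul_neg,
      Matrix.mul_assoc]
    rw [← Matrix.mul_assoc (evolutionOperator A r a) (evolutionOperator A a r),
      evolutionOperator_mul_swap hA ha' (hsub hr), Matrix.one_mul]
  initial := by
    rw [minEnergyState, evolutionOperator_self, gramian_self, Matrix.zero_mul, sub_zero,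
      Matrix.one_mul]
  terminal := by
    rw [minEnergyState, Matrix.mul_nonsing_inv _ ((Matrix.isUnit_iff_isUnit_det _).1 hW),
      sub_self, Matrix.mul_zero]

theorem hasDerivWithinAt_minEnergy (hA : ContinuousOn A (Icc 0 T)) (hB : ContinuousOn B (Icc 0 T))
    (ha : 0 ≤ a) (hab : a ≤ b) (hb : b ≤ T) (ht : t ∈ Icc a b) :
    HasDerivWithinAt (fun r => (gramian A B a b)⁻¹ * gramian A B a r * (gramian A B a b)⁻¹)
      ((minEnergyControl A B a b t)ᵀ * minEnergyControl A B a b t) (Icc a b) t := by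
  have hsub := Icc_subset_Icc ha hb
  refine ((hasDerivWithinAt_matrix_mul (hasDerivWithinAt_matrix_mul
    (hasDerivWithinAt_const t _ (gramian A B a b)⁻¹) (gramian_hasDerivWithinAt hA hB
      ⟨ha, hab.trans hb⟩ (hsub ht))) (hasDerivWithinAt_const t _ _)).mono hsub).congr_deriv ?_
  simp only [minEnergyControl, Matrix.zero_mul, zero_add, Matrix.mul_zero, add_zero,
    Matrix.transpose_neg, Matrix.neg_mul, Matrix.mul_neg, neg_neg,
    Matrix.transpose_mul _ (gramian A B a b)⁻¹,
    Matrix.transpose_nonsing_inv, transpose_eq_of_nonneg (gramian_nonneg hA hB ha hab hb),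
    Matrix.transpose_transpose, Matrix.mul_assoc]

theorem norm_minEnergyControl_le (hA : ContinuousOn A (Icc 0 T)) (ha : 0 ≤ a) (hb : b ≤ T)
    (hAK : ∀ r ∈ Icc a b, ‖A r‖ ≤ K) (hBc : ∀ r ∈ Icc a b, ‖B r‖ ≤ c) (hα₀ : 0 < α₀)
    (hW : α₀ • 1 ≤ gramian A B a b) (ht : t ∈ Icc a b) :
    ‖minEnergyControl A B a b t‖ ≤ c / α₀ * Real.exp (K * (t - a)) := by
  have hc : 0 ≤ c := (norm_nonneg _).trans (hBc t ht)
  have hΦ := norm_evolutionOperator_swap_le hA ha ht.1 (ht.2.trans hb)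
    fun r hr => hAK r (Icc_subset_Icc_right ht.2 hr)
  calc ‖minEnergyControl A B a b t‖
      ≤ ‖evolutionOperator A a t‖ * ‖B t‖ * ‖(gramian A B a b)⁻¹‖ := by
        rw [minEnergyControl, norm_neg]
        refine (Matrix.l2_opNorm_mul _ _).trans ?_
        rw [norm_transpose]
        gcongr
        exact Matrix.l2_opNorm_mul _ _
    _ ≤ Real.exp (K * (t - a)) * c * α₀⁻¹ := by
        gcongr
        exacts [hBc t ht, norm_inv_le hα₀ hW]
    _ = c / α₀ * Real.exp (K * (t - a)) := by ring

theorem norm_minEnergyState_le (hA : ContinuousOn A (Icc 0 T)) (hB : ContinuousOn B (Icc 0 T))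
    (ha : 0 ≤ a) (hb : b ≤ T) (hAK : ∀ r ∈ Icc a b, ‖A r‖ ≤ K) (hα₀ : 0 < α₀) (hα₁ : 0 ≤ α₁)
    (hW₀ : α₀ • 1 ≤ gramian A B a b) (hW₁ : gramian A B a b ≤ α₁ • 1) (ht : t ∈ Icc a b) :
    ‖minEnergyState A B a b t‖ ≤ (1 + α₁ / α₀) * Real.exp (K * (t - a)) := by
  have hab := ht.1.trans ht.2
  have hΦ := norm_evolutionOperator_le hA ha ht.1 (ht.2.trans hb)
    fun r hr => hAK r (Icc_subset_Icc_right ht.2 hr)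
  have hWt : ‖gramian A B a t‖ ≤ α₁ :=
    (norm_le_iff_le_smul_one (gramian_nonneg hA hB ha ht.1 (ht.2.trans hb)) hα₁).2
      ((gramian_monotoneOn hA hB ⟨ha, hab.trans hb⟩ (Icc_subset_Icc ha hb ht)
        ⟨ha.trans hab, hb⟩ ht.2).trans hW₁)
  calc ‖minEnergyState A B a b t‖
      ≤ ‖evolutionOperator A t a‖ * (‖(1 : Matrix (Fin n) (Fin n) ℝ)‖ +
          ‖gramian A B a t‖ * ‖(gramian A B a b)⁻¹‖) :=
        (norm_mul_le _ _).trans <| by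
          gcongr
          exact (norm_sub_le _ _).trans (add_le_add_right (norm_mul_le _ _) _)
    _ ≤ Real.exp (K * (t - a)) * (1 + α₁ * α₀⁻¹) := by
        gcongr
        exacts [norm_one_le, norm_inv_le hα₀ hW₀]
    _ = (1 + α₁ / α₀) * Real.exp (K * (t - a)) := by ring

/-- State feedback changes the Gramian by a bounded factor: the least-energy motion of `(A, B)` is
also a motion of `(A - B L, B)`, under the control `U + L X`. -/
theorem inv_smul_one_le_gramian_feedback {h : ℝ} {L : ℝ → Matrix (Fin m) (Fin n) ℝ}
    (hA : ContinuousOn A (Icc 0 T)) (hB : ContinuousOn B (Icc 0 T))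
    (hL : ContinuousOn L (Icc 0 T)) (ha : 0 ≤ a) (hab : a ≤ b) (hb : b ≤ T) (hK : 0 < K)
    (hAK : ∀ r ∈ Icc a b, ‖A r‖ ≤ K) (hLh : ∀ r ∈ Icc a b, ‖L r‖ ≤ h) (hα₀ : 0 < α₀)
    (hα₁ : 0 ≤ α₁) (hW₀ : α₀ • 1 ≤ gramian A B a b) (hW₁ : gramian A B a b ≤ α₁ • 1) :
    (2 / α₀ + 2 * (h * (1 + α₁ / α₀)) ^ 2 * growthIntegral K (b - a))⁻¹ • 1 ≤
      gramian (fun r => A r - B r * L r) B a b := by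
  set X := minEnergyState A B a b
  set U := minEnergyControl A B a b
  have hU := posDef_of_smul_one_le hα₀ hW₀ |>.isUnit
  have hg := growthIntegral_nonneg hK (sub_nonneg.2 hab)
  refine ((isSteering_minEnergy hA hB ha hab hb hU).feedback L).inv_smul_one_le_gramian
    (by fun_prop) hB ha hab hb (by positivity)
    (fun r hr => ((hasDerivWithinAt_minEnergy hA hB ha hab hb hr).const_smul (2 : ℝ)).add
      ((((hasDerivAt_growthIntegral hK.ne' (r - a)).comp_sub_const r a).const_mul
        (2 * (h * (1 + α₁ / α₀)) ^ 2)).smul_const 1).hasDerivWithinAt) (fun r hr => ?_) ?_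
  · have hLX : ‖L r * X r‖ ≤ h * (1 + α₁ / α₀) * Real.exp (K * (r - a)) := by
      rw [mul_assoc]
      exact (Matrix.l2_opNorm_mul _ _).trans (mul_le_mul (hLh r hr)
        (norm_minEnergyState_le hA hB ha hb hAK hα₀ hα₁ hW₀ hW₁ hr) (norm_nonneg _)
        ((norm_nonneg _).trans (hLh r hr)))
    refine (transpose_add_mul_add_le _ _).trans (add_le_add_right ?_ _)
    rw [mul_assoc, mul_smul, ← exp_mul_sq, ← mul_pow]
    exact smul_le_smul_of_nonneg_left
      ((transpose_mul_self_le_iff ((norm_nonneg _).trans hLX)).2 hLX) zero_le_two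
  · have hW := Matrix.nonsing_inv_mul _ ((Matrix.isUnit_iff_isUnit_det _).1 hU)
    simp only [Pi.add_apply, Pi.smul_apply, gramian_self, hW, Matrix.zero_mul,
      Matrix.one_mul, smul_zero, sub_self, growthIntegral_zero, mul_zero, zero_smul, sub_zero,
      add_zero]
    rw [add_smul]
    gcongr
    rw [div_eq_mul_inv, mul_smul]
    exact smul_le_smul_of_nonneg_left (inv_le_inv_smul_one hα₀ hW₀) zero_le_two

end MinEnergy

/-- The right-hand side `S G S - S F - Fᵀ S - P` of the matrix Riccati equation of the
linear-quadratic problem with drift `F`, running cost `P` and control weight `G = B R⁻¹ Bᵀ`. -/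
def riccatiField {ι : Type*} [Fintype ι] (F G P S : Matrix ι ι ℝ) : Matrix ι ι ℝ :=
  S * G * S - S * F - Fᵀ * S - P

/-- `S` is a symmetric solution on `[a, b]` of the Riccati equation, with no terminal condition
imposed. -/
structure IsSymmRiccatiSolution {ι : Type*} [Fintype ι] [DecidableEq ι] (F G P S : ℝ → Matrix ι ι ℝ)
    (a b : ℝ) : Prop where
  isSymm : ∀ t ∈ Icc a b, (S t)ᵀ = S t
  hasDerivWithinAt : ∀ t ∈ Icc a b,
    HasDerivWithinAt S (riccatiField (F t) (G t) (P t) (S t)) (Icc a b) t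

theorem zero_le_completed_square {ι κ ν : Type*} [Fintype ι] [Fintype κ] [DecidableEq κ] [Finite ν]
    {R : Matrix κ κ ℝ} (hR : R.PosDef) (B : Matrix ι κ ℝ) (Z : Matrix ι ν ℝ) (V : Matrix κ ν ℝ) :
    0 ≤ Zᵀ * (B * R⁻¹ * Bᵀ) * Z + Zᵀ * (B * V) + (B * V)ᵀ * Z + Vᵀ * R * V := by
  have hdet := (Matrix.isUnit_iff_isUnit_det _).1 hR.isUnit
  have hRt : Rᵀ = R := hR.isHermitian
  refine (transpose_mul_mul_nonneg hR.inv.posSemidef.nonneg (Bᵀ * Z + R * V)).trans_eq ?_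
  simp only [Matrix.transpose_add, Matrix.transpose_mul, Matrix.transpose_transpose, hRt,
    Matrix.add_mul, Matrix.mul_add, Matrix.mul_assoc, Matrix.mul_nonsing_inv_cancel_left _ _ hdet,
    Matrix.nonsing_inv_mul_cancel_left _ _ hdet]
  abel

namespace IsSymmRiccatiSolution

section Comparison

variable {ι : Type*} [Fintype ι] [DecidableEq ι] {a b : ℝ} {F G P S : ℝ → Matrix ι ι ℝ}

theorem mono {c d : ℝ} (hS : IsSymmRiccatiSolution F G P S a b) (hac : a ≤ c) (hdb : d ≤ b) :
    IsSymmRiccatiSolution F G P S c d where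
  isSymm t ht := hS.isSymm t (Icc_subset_Icc hac hdb ht)
  hasDerivWithinAt t ht :=
    (hS.hasDerivWithinAt t (Icc_subset_Icc hac hdb ht)).mono (Icc_subset_Icc hac hdb)

/-- Along a motion `Ẋ = F X + V`, the derivative of `Xᵀ S X` is
`Zᵀ G Z + Zᵀ V + Vᵀ Z - Xᵀ P X` with `Z = S X`. -/
theorem value_le_value_add {X V L L' : ℝ → Matrix ι ι ℝ} (hS : IsSymmRiccatiSolution F G P S a b)
    (hab : a ≤ b) (hX : ∀ r ∈ Icc a b, HasDerivWithinAt X (F r * X r + V r) (Icc a b) r)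
    (hL : ∀ r ∈ Icc a b, HasDerivWithinAt L (L' r) (Icc a b) r)
    (hcost : ∀ r ∈ Icc a b, ∀ Z : Matrix ι ι ℝ,
      (X r)ᵀ * P r * X r ≤ Zᵀ * G r * Z + Zᵀ * V r + (V r)ᵀ * Z + L' r) :
    (X a)ᵀ * S a * X a ≤ (X b)ᵀ * S b * X b + (L b - L a) := by
  have hmono := loewner_monotoneOn_of_deriv_nonneg
    (fun r hr => (hasDerivWithinAt_matrix_mul (hasDerivWithinAt_matrix_mul
      (hasDerivWithinAt_matrix_transpose (hX r hr)) (hS.hasDerivWithinAt r hr)) (hX r hr)).add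
      (hL r hr)) (fun r hr => ?_) (left_mem_Icc.2 hab) (right_mem_Icc.2 hab) hab
  · rw [← add_sub_assoc]
    exact le_sub_iff_add_le.2 hmono
  · refine (sub_nonneg.2 (hcost r hr (S r * X r))).trans_eq ?_
    simp only [riccatiField, Matrix.transpose_add, Matrix.transpose_mul, hS.isSymm r hr,
      Matrix.add_mul, Matrix.mul_add, Matrix.sub_mul, Matrix.mul_sub, Matrix.mul_assoc]
    abel

end Comparison

section UpperBounds

variable {n m : ℕ} {T t b μ q : ℝ} {F G P S : ℝ → Matrix (Fin n) (Fin n) ℝ}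

/-- Compare with the uncontrolled motion. -/
theorem le_of_terminal_le {qT : ℝ} (hS : IsSymmRiccatiSolution F G P S 0 T)
    (hF : ContinuousOn F (Icc 0 T)) (hμ : 0 < μ) (hFμ : ∀ r ∈ Icc 0 T, ‖F r‖ ≤ μ)
    (hG : ∀ r ∈ Icc 0 T, 0 ≤ G r) (hq : 0 ≤ q) (hP : ∀ r ∈ Icc 0 T, P r ≤ q • 1) (hqT : 0 ≤ qT)
    (hST : S T ≤ qT • 1) (ht : t ∈ Icc 0 T) :
    S t ≤ (qT * Real.exp (2 * μ * (T - t)) + q * growthIntegral μ (T - t)) • 1 := by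
  have hsub := Icc_subset_Icc_left ht.1 (b := T)
  have hΦ : ∀ r ∈ Icc t T, ‖evolutionOperator F r t‖ ≤ Real.exp (μ * (r - t)) := fun r hr =>
    norm_evolutionOperator_le hF ht.1 hr.1 hr.2
      fun u hu => hFμ u (hsub (Icc_subset_Icc_right hr.2 hu))
  have hvalue := (hS.mono ht.1 le_rfl).value_le_value_add ht.2 (V := fun _ => 0)
    (fun r hr => ((evolutionOperator_hasDerivWithinAt hF ht (hsub hr)).mono hsub).congr_deriv
      (add_zero _).symm)
    (fun r _ => ((((hasDerivAt_growthIntegral hμ.ne' (r - t)).comp_sub_const r t).const_mul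
      q).smul_const 1).hasDerivWithinAt) fun r hr Z => ?_
  · simp only [evolutionOperator_self, Matrix.transpose_one, Matrix.one_mul, Matrix.mul_one,
      sub_self, growthIntegral_zero, mul_zero, zero_smul, sub_zero] at hvalue
    refine hvalue.trans ?_
    rw [add_smul, ← exp_mul_sq]
    gcongr
    exact transpose_mul_mul_le hqT (Real.exp_pos _).le hST (hΦ T ⟨ht.2, le_rfl⟩)
  · rw [Matrix.mul_zero, Matrix.transpose_zero, Matrix.zero_mul, add_zero, add_zero, ← exp_mul_sq]
    exact (transpose_mul_mul_le hq (Real.exp_pos _).le (hP r (hsub hr)) (hΦ r hr)).trans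
      (le_add_of_nonneg_left (transpose_mul_mul_nonneg (hG r (hsub hr)) Z))

/-- Compare with the motion steered to the origin at time `b` with least energy. -/
theorem le_of_gramian_bounds {α₀ α₁ β ρ : ℝ} {B : ℝ → Matrix (Fin n) (Fin m) ℝ}
    {R : ℝ → Matrix (Fin m) (Fin m) ℝ}
    (hS : IsSymmRiccatiSolution F (fun r => B r * (R r)⁻¹ * (B r)ᵀ) P S t b)
    (hF : ContinuousOn F (Icc 0 T)) (hB : ContinuousOn B (Icc 0 T)) (ht : 0 ≤ t) (htb : t ≤ b)
    (hb : b ≤ T) (hμ : 0 < μ) (hFμ : ∀ r ∈ Icc t b, ‖F r‖ ≤ μ) (hBβ : ∀ r ∈ Icc t b, ‖B r‖ ≤ β)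
    (hR : ∀ r ∈ Icc t b, (R r).PosDef) (hρ : 0 ≤ ρ) (hRρ : ∀ r ∈ Icc t b, R r ≤ ρ • 1)
    (hq : 0 ≤ q) (hP : ∀ r ∈ Icc t b, P r ≤ q • 1) (hα₀ : 0 < α₀) (hα₁ : 0 ≤ α₁)
    (hW₀ : α₀ • 1 ≤ gramian F B t b) (hW₁ : gramian F B t b ≤ α₁ • 1) :
    S t ≤ ((q * (1 + α₁ / α₀) ^ 2 + ρ * (β / α₀) ^ 2) * growthIntegral μ (b - t)) • 1 := by
  set X := minEnergyState F B t b
  set U := minEnergyControl F B t b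
  have hsteer : IsSteering F B X U t b :=
    isSteering_minEnergy hF hB ht htb hb (posDef_of_smul_one_le hα₀ hW₀).isUnit
  have hvalue := hS.value_le_value_add htb hsteer.hasDerivWithinAt
    (fun r _ => ((((hasDerivAt_growthIntegral hμ.ne' (r - t)).comp_sub_const r t).const_mul
      (q * (1 + α₁ / α₀) ^ 2 + ρ * (β / α₀) ^ 2)).smul_const 1).hasDerivWithinAt)
    fun r hr Z => ?_
  · simpa only [hsteer.initial, hsteer.terminal, Matrix.transpose_one, Matrix.one_mul,
      Matrix.mul_one, Matrix.mul_zero, sub_self, growthIntegral_zero, mul_zero, zero_smul,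
      sub_zero, zero_add] using hvalue
  · have hβ : 0 ≤ β := (norm_nonneg _).trans (hBβ r hr)
    have hX := transpose_mul_mul_le hq (by positivity) (hP r hr)
      (norm_minEnergyState_le hF hB ht hb hFμ hα₀ hα₁ hW₀ hW₁ hr)
    have hU := transpose_mul_mul_le hρ (by positivity) (hRρ r hr)
      (norm_minEnergyControl_le hF ht hb hFμ hBβ hα₀ hW₀ hr)
    have hsq := zero_le_completed_square (hR r hr) (B r) Z (U r)
    calc (X r)ᵀ * P r * X r
        ≤ (q * ((1 + α₁ / α₀) * Real.exp (μ * (r - t))) ^ 2) • 1 + 0 := by rwa [add_zero]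
      _ ≤ _ := add_le_add_right hsq _
      _ ≤ _ := add_le_add_right (add_le_add_right hU _) _
      _ = _ := by
        rw [add_left_comm, ← add_smul, ← exp_mul_sq]
        congr 2
        ring

end UpperBounds

end IsSymmRiccatiSolution

section LinearEquation

variable {ι κ : Type*}

theorem hasDerivWithinAt_matrix_submatrix [Finite ι] [Finite κ] {ι' κ' : Type*} [Finite ι']
    [Finite κ'] {X : ℝ → Matrix ι κ ℝ} {X' : Matrix ι κ ℝ} {s : Set ℝ} {t : ℝ}
    (hX : HasDerivWithinAt X X' s t) (f : ι' → ι) (g : κ' → κ) :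
    HasDerivWithinAt (fun r => (X r).submatrix f g) (X'.submatrix f g) s t := by
  classical
  cases nonempty_fintype ι
  cases nonempty_fintype κ
  cases nonempty_fintype ι'
  cases nonempty_fintype κ'
  let restrict : Matrix ι κ ℝ →ₗ[ℝ] Matrix ι' κ' ℝ :=
    { toFun M := M.submatrix f g, map_add' _ _ := rfl, map_smul' _ _ := rfl }
  exact restrict.toContinuousLinearMap.hasFDerivAt.comp_hasDerivWithinAt t hX

theorem exists_forall_hasDerivWithinAt_mul [Fintype ι] [Finite κ] {T s : ℝ} {M : ℝ → Matrix ι ι ℝ}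
    (hM : ContinuousOn M (Icc 0 T)) (hs : s ∈ Icc 0 T) (N : Matrix ι κ ℝ) :
    ∃ Z : ℝ → Matrix ι κ ℝ, Z s = N ∧
      ∀ t ∈ Icc 0 T, HasDerivWithinAt Z (M t * Z t) (Icc 0 T) t := by
  classical
  cases nonempty_fintype κ
  let e := Fintype.equivFin ι
  let A : ℝ → Matrix _ _ ℝ := fun t => (M t).submatrix e.symm e.symm
  have hA : ContinuousOn A (Icc 0 T) :=
    (continuous_id.matrix_submatrix e.symm e.symm).comp_continuousOn hM
  refine ⟨fun t => (evolutionOperator A t s).submatrix e e * N, ?_, fun t ht => ?_⟩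
  · simp only [evolutionOperator_self, Matrix.submatrix_one_equiv, Matrix.one_mul]
  · refine (hasDerivWithinAt_matrix_mul (hasDerivWithinAt_matrix_submatrix
      (evolutionOperator_hasDerivWithinAt hA hs ht) e e)
      (hasDerivWithinAt_const t _ N)).congr_deriv ?_
    rw [Matrix.mul_zero, add_zero, ← Matrix.submatrix_mul_equiv _ _ _ e, Matrix.submatrix_submatrix,
      e.symm_comp_self, Matrix.submatrix_id_id, Matrix.mul_assoc]

end LinearEquation

/-- The linear Hamiltonian system of the Riccati equation: `Y X⁻¹` solves the latter wherever `X` is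
invertible. -/
structure IsHamiltonianSolution {ι : Type*} [Fintype ι] [DecidableEq ι]
    (F G P X Y : ℝ → Matrix ι ι ℝ) (a b : ℝ) : Prop where
  hasDerivWithinAt_state : ∀ t ∈ Icc a b,
    HasDerivWithinAt X (F t * X t - G t * Y t) (Icc a b) t
  hasDerivWithinAt_costate : ∀ t ∈ Icc a b,
    HasDerivWithinAt Y (-(P t * X t) - (F t)ᵀ * Y t) (Icc a b) t

section Existence

variable {ι : Type*} [Fintype ι] [DecidableEq ι] {F G P : ℝ → Matrix ι ι ℝ}

theorem exists_isHamiltonianSolution {T s : ℝ} (hF : ContinuousOn F (Icc 0 T))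
    (hG : ContinuousOn G (Icc 0 T)) (hP : ContinuousOn P (Icc 0 T)) (hs : s ∈ Icc 0 T)
    (X₀ Y₀ : Matrix ι ι ℝ) :
    ∃ X Y, X s = X₀ ∧ Y s = Y₀ ∧ IsHamiltonianSolution F G P X Y 0 T := by
  have hM : ContinuousOn (fun t => Matrix.fromBlocks (F t) (-G t) (-P t) (-(F t)ᵀ)) (Icc 0 T) := by
    rw [continuousOn_iff_continuous_domRestrict] at *
    exact hF.matrix_fromBlocks hG.neg hP.neg hF.matrix_transpose.neg
  obtain ⟨Z, hZs, hZ⟩ := exists_forall_hasDerivWithinAt_mul hM hs (Matrix.fromRows X₀ Y₀)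
  refine ⟨fun t => (Z t).toRows₁, fun t => (Z t).toRows₂, ?_, ?_,
    fun t ht => (hasDerivWithinAt_matrix_submatrix (hZ t ht) Sum.inl id).congr_deriv ?_,
    fun t ht => (hasDerivWithinAt_matrix_submatrix (hZ t ht) Sum.inr id).congr_deriv ?_⟩
  · simp only [hZs, Matrix.toRows₁_fromRows]
  · simp only [hZs, Matrix.toRows₂_fromRows]
  · ext i j
    simp [Matrix.mul_apply, Matrix.toRows₁, Matrix.toRows₂, sub_eq_add_neg]
  · ext i j
    simp [Matrix.mul_apply, Matrix.toRows₁, Matrix.toRows₂, sub_eq_add_neg]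

namespace IsHamiltonianSolution

variable {X Y : ℝ → Matrix ι ι ℝ} {a b t : ℝ}

/-- The derivative of `Xᵀ Y` is `-(Xᵀ P X + Yᵀ G Y)`. -/
theorem transpose_mul_antitoneOn (h : IsHamiltonianSolution F G P X Y a b)
    (hG : ∀ r ∈ Icc a b, 0 ≤ G r) (hP : ∀ r ∈ Icc a b, 0 ≤ P r) :
    AntitoneOn (fun r => (X r)ᵀ * Y r) (Icc a b) := by
  refine fun r hr t ht hrt => neg_le_neg_iff.1 (loewner_monotoneOn_of_deriv_nonneg
    (fun u hu => (hasDerivWithinAt_matrix_mul (hasDerivWithinAt_matrix_transpose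
      (h.hasDerivWithinAt_state u hu)) (h.hasDerivWithinAt_costate u hu)).neg)
    (fun u hu => ?_) hr ht hrt)
  refine (add_nonneg (transpose_mul_mul_nonneg (hP u hu) (X u))
    (transpose_mul_mul_nonneg (hG u hu) (Y u))).trans_eq ?_
  simp only [Matrix.transpose_sub, Matrix.transpose_mul, transpose_eq_of_nonneg (hG u hu),
    Matrix.sub_mul, Matrix.mul_sub, Matrix.mul_neg, Matrix.mul_assoc]
  abel

theorem posDef_transpose_mul (h : IsHamiltonianSolution F G P X Y a b)
    (hG : ∀ r ∈ Icc a b, 0 ≤ G r) (hP : ∀ r ∈ Icc a b, 0 ≤ P r) (hb : ((X b)ᵀ * Y b).PosDef)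
    (ht : t ∈ Icc a b) : ((X t)ᵀ * Y t).PosDef := by
  have hle := h.transpose_mul_antitoneOn hG hP ht ⟨ht.1.trans ht.2, le_rfl⟩ ht.2
  exact sub_add_cancel ((X t)ᵀ * Y t) _ ▸ Matrix.PosDef.posSemidef_add hle hb

theorem hasDerivWithinAt_costate_mul_inv (h : IsHamiltonianSolution F G P X Y a b)
    (ht : t ∈ Icc a b) (hX : IsUnit (X t)) :
    HasDerivWithinAt (fun r => Y r * (X r)⁻¹)
      (riccatiField (F t) (G t) (P t) (Y t * (X t)⁻¹)) (Icc a b) t := by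
  refine (hasDerivWithinAt_matrix_mul (h.hasDerivWithinAt_costate t ht)
    (hasDerivWithinAt_matrix_inv (h.hasDerivWithinAt_state t ht) hX)).congr_deriv ?_
  have hinv := Matrix.mul_nonsing_inv _ ((Matrix.isUnit_iff_isUnit_det _).1 hX)
  simp only [riccatiField, Matrix.sub_mul, Matrix.mul_sub, Matrix.neg_mul, Matrix.mul_neg,
    Matrix.mul_assoc, hinv, Matrix.mul_one]
  abel

end IsHamiltonianSolution

theorem exists_posDef_isSymmRiccatiSolution {T : ℝ} (hT : 0 ≤ T) (hF : ContinuousOn F (Icc 0 T))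
    (hG : ContinuousOn G (Icc 0 T)) (hP : ContinuousOn P (Icc 0 T))
    (hG₀ : ∀ t ∈ Icc 0 T, 0 ≤ G t) (hP₀ : ∀ t ∈ Icc 0 T, 0 ≤ P t) {QT : Matrix ι ι ℝ}
    (hQT : QT.PosDef) :
    ∃ S, IsSymmRiccatiSolution F G P S 0 T ∧ S T = QT ∧ ∀ t ∈ Icc 0 T, (S t).PosDef := by
  obtain ⟨X, Y, hXT, hYT, hXY⟩ := exists_isHamiltonianSolution hF hG hP ⟨hT, le_rfl⟩ 1 QT
  have hpos : ∀ t ∈ Icc 0 T, ((X t)ᵀ * Y t).PosDef := fun t ht =>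
    hXY.posDef_transpose_mul hG₀ hP₀
      (by rwa [hXT, hYT, Matrix.transpose_one, Matrix.one_mul]) ht
  have hX : ∀ t ∈ Icc 0 T, IsUnit (X t) := fun t ht =>
    (Matrix.isUnit_transpose _).1 (isUnit_of_mul_isUnit_left (hpos t ht).isUnit)
  have hS : ∀ t ∈ Icc 0 T, (Y t * (X t)⁻¹).PosDef := fun t ht => by
    have hdet := (Matrix.isUnit_iff_isUnit_det _).1 ((Matrix.isUnit_transpose _).2 (hX t ht))
    have hcongr := (Matrix.IsUnit.posDef_star_left_conjugate_iff
      (Matrix.isUnit_nonsing_inv_iff.2 (hX t ht))).2 (hpos t ht)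
    rwa [Matrix.star_eq_conjTranspose, Matrix.conjTranspose_eq_transpose_of_trivial,
      Matrix.transpose_nonsing_inv, Matrix.nonsing_inv_mul_cancel_left _ _ hdet] at hcongr
  exact ⟨fun t => Y t * (X t)⁻¹,
    ⟨fun t ht => (hS t ht).isHermitian, fun t ht =>
      hXY.hasDerivWithinAt_costate_mul_inv ht (hX t ht)⟩,
    by simp only [hXT, hYT, inv_one, Matrix.mul_one], hS⟩

end Existence

/-- The difference of two solutions satisfies the linear equation
`Δ' = -(Fᵀ - S₁ G) Δ - Δ (F - G S₂)`. -/
theorem eqOn_of_hasDerivWithinAt_riccatiField {ι : Type*} [Fintype ι] {T : ℝ}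
    {F G P S₁ S₂ : ℝ → Matrix ι ι ℝ} (hF : ContinuousOn F (Icc 0 T))
    (hG : ContinuousOn G (Icc 0 T)) (hS₁ : ContinuousOn S₁ (Icc 0 T))
    (hS₂ : ContinuousOn S₂ (Icc 0 T))
    (hS₁' : ∀ t ∈ Ico 0 T,
      HasDerivWithinAt S₁ (riccatiField (F t) (G t) (P t) (S₁ t)) (Icc 0 T) t)
    (hS₂' : ∀ t ∈ Ico 0 T,
      HasDerivWithinAt S₂ (riccatiField (F t) (G t) (P t) (S₂ t)) (Icc 0 T) t)
    (hT : S₁ T = S₂ T) : EqOn S₁ S₂ (Icc 0 T) := by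
  classical
  intro t ht
  have hsub := Icc_subset_Icc_left ht.1 (b := T)
  have hA₁ : ContinuousOn (fun r => F r - (G r)ᵀ * (S₁ r)ᵀ) (Icc 0 T) := by fun_prop
  have hA₂ : ContinuousOn (fun r => F r - G r * S₂ r) (Icc 0 T) := by fun_prop
  obtain ⟨Φ₁, hΦ₁t, hΦ₁⟩ := exists_forall_hasDerivWithinAt_mul hA₁ ht (1 : Matrix ι ι ℝ)
  obtain ⟨Φ₂, hΦ₂t, hΦ₂⟩ := exists_forall_hasDerivWithinAt_mul hA₂ ht (1 : Matrix ι ι ℝ)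
  have hconst := eq_left_of_hasDerivWithinAt_zero
    (f := fun r => (Φ₁ r)ᵀ * (S₁ r - S₂ r) * Φ₂ r) (a := t) (b := T)
    (by
      have hc₁ : ContinuousOn Φ₁ (Icc 0 T) := fun r hr => (hΦ₁ r hr).continuousWithinAt
      have hc₂ : ContinuousOn Φ₂ (Icc 0 T) := fun r hr => (hΦ₂ r hr).continuousWithinAt
      exact ContinuousOn.mono (by fun_prop) hsub)
    (fun r hr => by
      have hrT : r ∈ Ico 0 T := ⟨ht.1.trans hr.1, hr.2⟩
      have hrT' := Ico_subset_Icc_self hrT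
      refine ((hasDerivWithinAt_matrix_mul (hasDerivWithinAt_matrix_mul
        (hasDerivWithinAt_matrix_transpose (hΦ₁ r hrT')) ((hS₁' r hrT).sub (hS₂' r hrT)))
        (hΦ₂ r hrT')).mono hsub).congr_deriv ?_
      simp only [riccatiField, Matrix.transpose_sub, Matrix.transpose_mul,
        Matrix.transpose_transpose, Matrix.add_mul, Matrix.sub_mul, Matrix.mul_sub, Pi.sub_apply,
        Matrix.mul_assoc]
      abel) ⟨ht.2, le_rfl⟩
  simp only [hT, hΦ₁t, hΦ₂t, sub_self, Matrix.mul_zero, Matrix.zero_mul, Matrix.transpose_one,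
    Matrix.one_mul, Matrix.mul_one] at hconst
  exact sub_eq_zero.1 hconst.symm

namespace IsSymmRiccatiSolution

theorem inv {ι : Type*} [Fintype ι] [DecidableEq ι] {F G P S : ℝ → Matrix ι ι ℝ} {a b : ℝ}
    (hS : IsSymmRiccatiSolution F G P S a b) (hu : ∀ t ∈ Icc a b, IsUnit (S t)) :
    IsSymmRiccatiSolution (fun t => -(F t)ᵀ) P G (fun t => (S t)⁻¹) a b where
  isSymm t ht := by rw [Matrix.transpose_nonsing_inv, hS.isSymm t ht]
  hasDerivWithinAt t ht := by
    refine (hasDerivWithinAt_matrix_inv (hS.hasDerivWithinAt t ht) (hu t ht)).congr_deriv ?_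
    have hdet := (Matrix.isUnit_iff_isUnit_det _).1 (hu t ht)
    simp only [riccatiField, Matrix.mul_sub, Matrix.sub_mul, Matrix.mul_assoc,
      Matrix.nonsing_inv_mul_cancel_left _ _ hdet, Matrix.mul_nonsing_inv _ hdet,
      Matrix.transpose_neg, Matrix.transpose_transpose, Matrix.neg_mul, Matrix.mul_neg,
      Matrix.mul_one]
    abel

end IsSymmRiccatiSolution

section InverseBounds

namespace IsSymmRiccatiSolution

variable {n : ℕ} {T t b μ g γ : ℝ} {F G P S : ℝ → Matrix (Fin n) (Fin n) ℝ}

theorem inv_le_of_le_terminal (hS : IsSymmRiccatiSolution F G P S 0 T)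
    (hpos : ∀ r ∈ Icc 0 T, (S r).PosDef) (hF : ContinuousOn F (Icc 0 T)) (hμ : 0 < μ)
    (hFμ : ∀ r ∈ Icc 0 T, ‖F r‖ ≤ μ) (hg : 0 ≤ g) (hG : ∀ r ∈ Icc 0 T, G r ≤ g • 1)
    (hP : ∀ r ∈ Icc 0 T, 0 ≤ P r) (hγ : 0 < γ) (hST : γ • 1 ≤ S T) (ht : t ∈ Icc 0 T) :
    (S t)⁻¹ ≤ (γ⁻¹ * Real.exp (2 * μ * (T - t)) + g * growthIntegral μ (T - t)) • 1 :=
  (hS.inv fun r hr => (hpos r hr).isUnit).le_of_terminal_le (by fun_prop) hμ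
    (fun r hr => by simpa only [norm_neg, norm_transpose] using hFμ r hr) hP hg hG
    (inv_nonneg.2 hγ.le) (inv_le_inv_smul_one hγ hST) ht

theorem inv_le_of_smul_one_le_cost (hS : IsSymmRiccatiSolution F G P S t b)
    (hpos : ∀ r ∈ Icc t b, (S r).PosDef) (hF : ContinuousOn F (Icc 0 T)) (ht : 0 ≤ t)
    (htb : t < b) (hb : b ≤ T) (hμ : 0 < μ) (hFμ : ∀ r ∈ Icc t b, ‖F r‖ ≤ μ) (hg : 0 ≤ g)
    (hG : ∀ r ∈ Icc t b, G r ≤ g • 1) (hγ : 0 < γ) (hP : ∀ r ∈ Icc t b, γ • 1 ≤ P r) :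
    (S t)⁻¹ ≤ ((g * (1 + growthIntegral μ (b - t) / growthIntegral (-μ) (b - t)) ^ 2 +
      γ⁻¹ * (1 / growthIntegral (-μ) (b - t)) ^ 2) * growthIntegral μ (b - t)) • 1 := by
  have hPpos : ∀ r ∈ Icc t b, (P r).PosDef := fun r hr => posDef_of_smul_one_le hγ (hP r hr)
  have hF' : ContinuousOn (fun r => -(F r)ᵀ) (Icc 0 T) := by fun_prop
  have hFμ' : ∀ r ∈ Icc t b, ‖-(F r)ᵀ‖ ≤ μ := fun r hr => by
    simpa only [norm_neg, norm_transpose] using hFμ r hr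
  have hdual : IsSymmRiccatiSolution (fun r => -(F r)ᵀ)
      (fun r => 1 * ((P r)⁻¹)⁻¹ * (1 : Matrix (Fin n) (Fin n) ℝ)ᵀ) G (fun r => (S r)⁻¹) t b :=
    { isSymm := (hS.inv fun r hr => (hpos r hr).isUnit).isSymm
      hasDerivWithinAt r hr := by
        simpa only [Matrix.transpose_one, Matrix.one_mul, Matrix.mul_one,
          Matrix.nonsing_inv_nonsing_inv _ ((Matrix.isUnit_iff_isUnit_det _).1
            (hPpos r hr).isUnit)] using
          (hS.inv fun r hr => (hpos r hr).isUnit).hasDerivWithinAt r hr }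
  refine hdual.le_of_gramian_bounds hF' continuousOn_const ht htb.le hb hμ hFμ'
    (fun _ _ => norm_one_le) (fun r hr => (hPpos r hr).inv) (inv_nonneg.2 hγ.le)
    (fun r hr => inv_le_inv_smul_one hγ (hP r hr)) hg hG ?_
    (growthIntegral_nonneg hμ (sub_nonneg.2 htb.le))
    (le_gramian_one hF' ht htb.le hb hμ hFμ') ?_
  · rw [growthIntegral_neg]
    exact mul_pos (Real.exp_pos _) (growthIntegral_pos hμ (sub_pos.2 htb))
  · simpa only [one_pow, one_mul] using gramian_le hF' continuousOn_const ht htb.le hb hμ hFμ'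
      fun _ _ => norm_one_le

end IsSymmRiccatiSolution

end InverseBounds

theorem smul_one_le_of_inv_le_smul_one {ι : Type*} [Fintype ι] [DecidableEq ι] {M : Matrix ι ι ℝ}
    {c d : ℝ} (hM : M.PosDef) (hd : 0 < d) (hdc : c ≤ d⁻¹) (h : M⁻¹ ≤ d • 1) : c • 1 ≤ M := by
  have hinv := (inv_le_iff_inv_le hM (Matrix.PosDef.one.smul hd)).1 h
  rw [Matrix.inv_eq_right_inv (show d • (1 : Matrix ι ι ℝ) * d⁻¹ • 1 = 1 by simp [hd.ne'])] at hinv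
  exact (smul_one_le_smul_one hdc).trans hinv

section Constants

variable {lamA lamB lamQ lamH lamR γR γQ α₀ α₁ σ s : ℝ}

theorem dualAlpha₀_eq_growthIntegral (lamA lamB lamH γR σ : ℝ) :
    dualAlpha₀ lamA lamB lamH γR σ = growthIntegral (-growthRate lamA lamB lamH γR) σ := by
  unfold dualAlpha₀ growthIntegral
  rw [mul_neg, div_neg, ← neg_div, neg_sub, neg_mul 2, one_div_mul_eq_div]

theorem dualAlpha₁_eq_growthIntegral (lamA lamB lamH γR σ : ℝ) :
    dualAlpha₁ lamA lamB lamH γR σ = growthIntegral (growthRate lamA lamB lamH γR) σ :=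
  one_div_mul_eq_div _ _

theorem shiftedAlpha₁_eq_growthIntegral (lamA lamB lamH γR σ : ℝ) :
    shiftedAlpha₁ lamA lamB lamH γR σ =
      lamB ^ 2 * growthIntegral (growthRate lamA lamB lamH γR) σ := by
  unfold shiftedAlpha₁ growthIntegral
  rw [mul_right_comm 2 σ, mul_div_assoc]

theorem shiftedAlpha₀_eq_growthIntegral (hA : lamA ≠ 0) :
    shiftedAlpha₀ lamA lamH γR α₀ α₁ σ =
      (2 / α₀ + 2 * (lamH / γR * (1 + α₁ / α₀)) ^ 2 * growthIntegral lamA σ)⁻¹ := by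
  unfold shiftedAlpha₀ growthIntegral
  field_simp

theorem dualAlpha₀_pos (hμ : 0 < growthRate lamA lamB lamH γR) (hσ : 0 < σ) :
    0 < dualAlpha₀ lamA lamB lamH γR σ := by
  rw [dualAlpha₀_eq_growthIntegral, growthIntegral_neg]
  exact mul_pos (Real.exp_pos _) (growthIntegral_pos hμ hσ)

theorem dualAlpha₁_pos (hμ : 0 < growthRate lamA lamB lamH γR) (hσ : 0 < σ) :
    0 < dualAlpha₁ lamA lamB lamH γR σ :=
  (growthIntegral_pos hμ hσ).trans_eq (dualAlpha₁_eq_growthIntegral _ _ _ _ _).symm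

theorem shiftedAlpha₀_pos (hA : 0 < lamA) (hα₀ : 0 < α₀) (hσ : 0 < σ) :
    0 < shiftedAlpha₀ lamA lamH γR α₀ α₁ σ := by
  have := growthIntegral_pos hA hσ
  rw [shiftedAlpha₀_eq_growthIntegral hA.ne']
  positivity

theorem shiftedAlpha₁_pos (hB : 0 < lamB) (hμ : 0 < growthRate lamA lamB lamH γR) (hσ : 0 < σ) :
    0 < shiftedAlpha₁ lamA lamB lamH γR σ := by
  have := growthIntegral_pos hμ hσ
  rw [shiftedAlpha₁_eq_growthIntegral]
  positivity

theorem shiftedAlpha₀_le (hA : 0 < lamA) (hα₀ : 0 < α₀) (hs : 0 ≤ s) (hsσ : s ≤ σ) :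
    shiftedAlpha₀ lamA lamH γR α₀ α₁ σ ≤
      (2 / α₀ + 2 * (lamH / γR * (1 + α₁ / α₀)) ^ 2 * growthIntegral lamA s)⁻¹ := by
  have := growthIntegral_nonneg hA hs
  have := growthIntegral_mono hA hsσ
  rw [shiftedAlpha₀_eq_growthIntegral hA.ne']
  gcongr

theorem riccatiLower_pos (hB : 0 < lamB) (hμ : 0 < growthRate lamA lamB lamH γR) (hγR : 0 < γR)
    (hγQ : 0 < γQ) (hσ : 0 < σ) : 0 < riccatiLower lamA lamB lamH γR γQ σ := by
  have := dualAlpha₀_pos hμ hσ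
  have := dualAlpha₁_pos hμ hσ
  unfold riccatiLower
  refine mul_pos (lt_min ?_ ?_) (Real.exp_pos _) <;> positivity

theorem riccatiUpper_pos (hμ : 0 < growthRate lamA lamB lamH γR) (hQ : 0 < lamQ) (hγR : 0 < γR) :
    0 < riccatiUpper lamA lamB lamQ lamH lamR γR α₀ α₁ σ := by
  unfold riccatiUpper
  exact mul_pos (lt_max_of_lt_right (by positivity)) (Real.exp_pos _)

theorem riccatiLower_le_inv_window (hB : 0 < lamB) (hμ : 0 < growthRate lamA lamB lamH γR)
    (hγR : 0 < γR) (hγQ : 0 < γQ) (hσ : 0 < σ) :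
    riccatiLower lamA lamB lamH γR γQ σ ≤
      ((lamB ^ 2 / γR *
          (1 + dualAlpha₁ lamA lamB lamH γR σ / dualAlpha₀ lamA lamB lamH γR σ) ^ 2 +
        γQ⁻¹ * (1 / dualAlpha₀ lamA lamB lamH γR σ) ^ 2) *
          growthIntegral (growthRate lamA lamB lamH γR) σ)⁻¹ := by
  have h₀ := dualAlpha₀_pos hμ hσ
  have h₁ := dualAlpha₁_pos hμ hσ
  have hI := growthIntegral_pos hμ hσ
  have hexp := growthIntegral_le_exp hμ (le_refl σ)
  refine (mul_le_mul_of_nonneg_right (min_le_left _ _) (Real.exp_pos _).le).trans ?_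
  generalize dualAlpha₀ lamA lamB lamH γR σ = a₀ at *
  generalize dualAlpha₁ lamA lamB lamH γR σ = a₁ at *
  generalize growthRate lamA lamB lamH γR = μ at *
  calc 2 * μ * (lamB ^ 2 / γR * (1 + a₁ / a₀) ^ 2 + 1 / (γQ * a₀ ^ 2))⁻¹ * Real.exp (-2 * μ * σ)
      = ((lamB ^ 2 / γR * (1 + a₁ / a₀) ^ 2 + γQ⁻¹ * (1 / a₀) ^ 2) *
          (Real.exp (2 * μ * σ) * (1 / (2 * μ))))⁻¹ := by
        rw [neg_mul, neg_mul, Real.exp_neg, one_div_pow, ← one_div γQ, one_div_mul_one_div]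
        simp only [mul_inv, one_div, inv_inv]
        ring
    _ ≤ _ := inv_anti₀ (by positivity) (by gcongr)

theorem riccatiLower_le_inv_terminal (hμ : 0 < growthRate lamA lamB lamH γR) (hγR : 0 < γR)
    (hγQ : 0 < γQ) (hs : 0 ≤ s) (hsσ : s ≤ σ) :
    riccatiLower lamA lamB lamH γR γQ σ ≤
      (γQ⁻¹ * Real.exp (2 * growthRate lamA lamB lamH γR * s) +
        lamB ^ 2 / γR * growthIntegral (growthRate lamA lamB lamH γR) s)⁻¹ := by
  have hI := growthIntegral_nonneg hμ hs
  have hexp := growthIntegral_le_exp hμ hsσ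
  refine (mul_le_mul_of_nonneg_right (min_le_right _ _) (Real.exp_pos _).le).trans ?_
  generalize growthRate lamA lamB lamH γR = μ at *
  calc (lamB ^ 2 / (2 * γR * μ) + 1 / γQ)⁻¹ * Real.exp (-2 * μ * σ)
      = (γQ⁻¹ * Real.exp (2 * μ * σ) +
          lamB ^ 2 / γR * (Real.exp (2 * μ * σ) * (1 / (2 * μ))))⁻¹ := by
        rw [neg_mul, neg_mul, Real.exp_neg, ← mul_inv]
        congr 1
        field_simp
        ring
    _ ≤ _ := inv_anti₀ (by positivity) (by gcongr)

theorem window_le_riccatiUpper (hA : 0 < lamA) (hB : 0 < lamB)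
    (hμ : 0 < growthRate lamA lamB lamH γR) (hQ : 0 ≤ lamQ) (hR : 0 ≤ lamR)
    (hγR : 0 < γR) (hα₀ : 0 < α₀) (hσ : 0 < σ) (hsσ : s ≤ σ) :
    (lamQ * (1 + shiftedAlpha₁ lamA lamB lamH γR σ / shiftedAlpha₀ lamA lamH γR α₀ α₁ σ) ^ 2 +
        lamR * (lamB / shiftedAlpha₀ lamA lamH γR α₀ α₁ σ) ^ 2) *
          growthIntegral (growthRate lamA lamB lamH γR) s ≤
      riccatiUpper lamA lamB lamQ lamH lamR γR α₀ α₁ σ := by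
  have h₀ := shiftedAlpha₀_pos (lamH := lamH) (γR := γR) (α₁ := α₁) hA hα₀ hσ
  have h₁ := shiftedAlpha₁_pos hB hμ hσ
  have hexp := growthIntegral_le_exp hμ hsσ
  have hq : lamQ ≤ lamQ + lamH ^ 2 / γR := le_add_of_nonneg_right (by positivity)
  refine le_trans ?_ (mul_le_mul_of_nonneg_right (le_max_left _ _) (Real.exp_pos _).le)
  generalize shiftedAlpha₀ lamA lamH γR α₀ α₁ σ = a₀ at *
  generalize shiftedAlpha₁ lamA lamB lamH γR σ = a₁ at *
  generalize growthRate lamA lamB lamH γR = μ at *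
  calc (lamQ * (1 + a₁ / a₀) ^ 2 + lamR * (lamB / a₀) ^ 2) * growthIntegral μ s
      ≤ (lamQ * (1 + a₁ / a₀) ^ 2 + lamR * (lamB / a₀) ^ 2) *
          (Real.exp (2 * μ * σ) * (1 / (2 * μ))) := by gcongr
    _ ≤ ((lamQ + lamH ^ 2 / γR) * (1 + a₁ / a₀) ^ 2 + lamR * (lamB / a₀) ^ 2) *
          (Real.exp (2 * μ * σ) * (1 / (2 * μ))) := by gcongr
    _ = _ := by ring

theorem terminal_le_riccatiUpper (hμ : 0 < growthRate lamA lamB lamH γR) (hQ : 0 ≤ lamQ)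
    (hγR : 0 < γR) (hsσ : s ≤ σ) :
    lamQ * Real.exp (2 * growthRate lamA lamB lamH γR * s) +
        lamQ * growthIntegral (growthRate lamA lamB lamH γR) s ≤
      riccatiUpper lamA lamB lamQ lamH lamR γR α₀ α₁ σ := by
  have hexp := growthIntegral_le_exp hμ hsσ
  have hq : lamQ ≤ lamQ + lamH ^ 2 / γR := le_add_of_nonneg_right (by positivity)
  refine le_trans ?_ (mul_le_mul_of_nonneg_right (le_max_right _ _) (Real.exp_pos _).le)
  generalize growthRate lamA lamB lamH γR = μ at *
  calc lamQ * Real.exp (2 * μ * s) + lamQ * growthIntegral μ s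
      ≤ lamQ * Real.exp (2 * μ * σ) + lamQ * (Real.exp (2 * μ * σ) * (1 / (2 * μ))) := by gcongr
    _ = lamQ * (1 + 1 / (2 * μ)) * Real.exp (2 * μ * σ) := by ring
    _ ≤ _ := by gcongr

end Constants

section Coefficients

variable {n m : ℕ}

/-- The drift `A - B R⁻¹ H` left after the cross term `H` has been removed from the cost by the
feedback `u = v - R⁻¹ H x`. -/
noncomputable def shiftedDrift (A : ℝ → Matrix (Fin n) (Fin n) ℝ) (B : ℝ → Matrix (Fin n) (Fin m) ℝ)
    (H : ℝ → Matrix (Fin m) (Fin n) ℝ) (R : ℝ → Matrix (Fin m) (Fin m) ℝ) (t : ℝ) :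
    Matrix (Fin n) (Fin n) ℝ :=
  A t - B t * ((R t)⁻¹ * H t)

/-- The control weight `B R⁻¹ Bᵀ`, the quadratic coefficient of the Riccati equation. -/
noncomputable def controlWeight (B : ℝ → Matrix (Fin n) (Fin m) ℝ)
    (R : ℝ → Matrix (Fin m) (Fin m) ℝ) (t : ℝ) : Matrix (Fin n) (Fin n) ℝ :=
  B t * (R t)⁻¹ * (B t)ᵀ

/-- The state cost `Q - Hᵀ R⁻¹ H` left after the cross term `H` has been removed by the feedback
`u = v - R⁻¹ H x`. -/
noncomputable def shiftedCost (Q : ℝ → Matrix (Fin n) (Fin n) ℝ)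
    (H : ℝ → Matrix (Fin m) (Fin n) ℝ) (R : ℝ → Matrix (Fin m) (Fin m) ℝ) (t : ℝ) :
    Matrix (Fin n) (Fin n) ℝ :=
  Q t - (H t)ᵀ * (R t)⁻¹ * H t

variable {T lamA lamB lamQ lamH lamR γR γQ t : ℝ} {A : ℝ → Matrix (Fin n) (Fin n) ℝ}
  {B : ℝ → Matrix (Fin n) (Fin m) ℝ} {Q : ℝ → Matrix (Fin n) (Fin n) ℝ}
  {H : ℝ → Matrix (Fin m) (Fin n) ℝ} {R : ℝ → Matrix (Fin m) (Fin m) ℝ}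
  {QT : Matrix (Fin n) (Fin n) ℝ} {S : ℝ → Matrix (Fin n) (Fin n) ℝ}

theorem isRiccatiSolution_iff : IsRiccatiSolution T A B Q H R QT S ↔
    ContinuousOn S (Icc 0 T) ∧
      (∀ t ∈ Ico 0 T, HasDerivWithinAt S
        (riccatiField (shiftedDrift A B H R t) (controlWeight B R t) (shiftedCost Q H R t) (S t))
        (Icc 0 T) t) ∧ S T = QT := by
  simp only [riccatiField, shiftedDrift, controlWeight, shiftedCost, ← Matrix.mul_assoc]
  exact ⟨fun ⟨hc, hd, hT⟩ => ⟨hc, hd, hT⟩, fun ⟨hc, hd, hT⟩ => ⟨hc, hd, hT⟩⟩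

namespace CoerciveCost

theorem posDef_R (h : CoerciveCost T γR γQ lamQ Q H R QT) (ht : t ∈ Icc 0 T) : (R t).PosDef :=
  posDef_of_smul_one_le h.γR_pos (h.le_R t ht)

theorem zero_le_shiftedCost (h : CoerciveCost T γR γQ lamQ Q H R QT) (ht : t ∈ Icc 0 T) :
    0 ≤ shiftedCost Q H R t :=
  (posDef_of_smul_one_le h.γQ_pos (h.le_Q t ht)).posSemidef.nonneg

theorem zero_le_controlWeight (h : CoerciveCost T γR γQ lamQ Q H R QT)
    (B : ℝ → Matrix (Fin n) (Fin m) ℝ) (ht : t ∈ Icc 0 T) : 0 ≤ controlWeight B R t := by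
  simpa only [controlWeight, Matrix.transpose_transpose] using
    transpose_mul_mul_nonneg (h.posDef_R ht).inv.posSemidef.nonneg (B t)ᵀ

end CoerciveCost

namespace BoundedData

theorem continuousOn_inv_R (h : BoundedData T lamA lamB lamQ lamH lamR A B Q H R)
    (hc : CoerciveCost T γR γQ lamQ Q H R QT) : ContinuousOn (fun t => (R t)⁻¹) (Icc 0 T) :=
  continuousOn_matrix_inv h.continuousOn_R fun _ ht => (hc.posDef_R ht).isUnit

theorem continuousOn_inv_mul_H (h : BoundedData T lamA lamB lamQ lamH lamR A B Q H R)
    (hc : CoerciveCost T γR γQ lamQ Q H R QT) :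
    ContinuousOn (fun t => (R t)⁻¹ * H t) (Icc 0 T) := by
  have hR := h.continuousOn_inv_R hc
  have hH := h.continuousOn_H
  fun_prop

theorem continuousOn_shiftedDrift (h : BoundedData T lamA lamB lamQ lamH lamR A B Q H R)
    (hc : CoerciveCost T γR γQ lamQ Q H R QT) :
    ContinuousOn (shiftedDrift A B H R) (Icc 0 T) := by
  have hA := h.continuousOn_A
  have hB := h.continuousOn_B
  have hRH := h.continuousOn_inv_mul_H hc
  exact hA.sub (by fun_prop)

theorem continuousOn_controlWeight (h : BoundedData T lamA lamB lamQ lamH lamR A B Q H R)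
    (hc : CoerciveCost T γR γQ lamQ Q H R QT) :
    ContinuousOn (controlWeight B R) (Icc 0 T) := by
  have hB := h.continuousOn_B
  have hR := h.continuousOn_inv_R hc
  unfold controlWeight
  fun_prop

theorem continuousOn_shiftedCost (h : BoundedData T lamA lamB lamQ lamH lamR A B Q H R)
    (hc : CoerciveCost T γR γQ lamQ Q H R QT) :
    ContinuousOn (shiftedCost Q H R) (Icc 0 T) := by
  have hQ := h.continuousOn_Q
  have hH := h.continuousOn_H
  have hR := h.continuousOn_inv_R hc
  unfold shiftedCost
  fun_prop

theorem R_le (h : BoundedData T lamA lamB lamQ lamH lamR A B Q H R)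
    (hc : CoerciveCost T γR γQ lamQ Q H R QT) (ht : t ∈ Icc 0 T) : R t ≤ lamR • 1 :=
  (norm_le_iff_le_smul_one (hc.posDef_R ht).posSemidef.nonneg h.lamR_pos.le).1 (h.norm_R_le t ht)

theorem norm_inv_mul_H_le (h : BoundedData T lamA lamB lamQ lamH lamR A B Q H R)
    (hc : CoerciveCost T γR γQ lamQ Q H R QT) (ht : t ∈ Icc 0 T) :
    ‖(R t)⁻¹ * H t‖ ≤ lamH / γR :=
  calc ‖(R t)⁻¹ * H t‖ ≤ ‖(R t)⁻¹‖ * ‖H t‖ := Matrix.l2_opNorm_mul _ _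
    _ ≤ γR⁻¹ * lamH := mul_le_mul (norm_inv_le hc.γR_pos (hc.le_R t ht)) (h.norm_H_le t ht)
        (norm_nonneg _) (inv_nonneg.2 hc.γR_pos.le)
    _ = lamH / γR := by rw [div_eq_inv_mul]

theorem norm_shiftedDrift_le (h : BoundedData T lamA lamB lamQ lamH lamR A B Q H R)
    (hc : CoerciveCost T γR γQ lamQ Q H R QT) (ht : t ∈ Icc 0 T) :
    ‖shiftedDrift A B H R t‖ ≤ growthRate lamA lamB lamH γR :=
  calc ‖shiftedDrift A B H R t‖ ≤ ‖A t‖ + ‖B t * ((R t)⁻¹ * H t)‖ := norm_sub_le _ _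
    _ ≤ lamA + lamB * (lamH / γR) := add_le_add (h.norm_A_le t ht)
        ((Matrix.l2_opNorm_mul _ _).trans (mul_le_mul (h.norm_B_le t ht)
          (h.norm_inv_mul_H_le hc ht) (norm_nonneg _) h.lamB_pos.le))
    _ = growthRate lamA lamB lamH γR := by rw [growthRate, mul_div_assoc]

theorem controlWeight_le (h : BoundedData T lamA lamB lamQ lamH lamR A B Q H R)
    (hc : CoerciveCost T γR γQ lamQ Q H R QT) (ht : t ∈ Icc 0 T) :
    controlWeight B R t ≤ (lamB ^ 2 / γR) • 1 := by
  have hBt : ‖(B t)ᵀ‖ ≤ lamB := (norm_transpose (B t)).trans_le (h.norm_B_le t ht)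
  simpa only [controlWeight, Matrix.transpose_transpose, div_eq_inv_mul] using
    transpose_mul_mul_le (inv_nonneg.2 hc.γR_pos.le) h.lamB_pos.le
      (inv_le_inv_smul_one hc.γR_pos (hc.le_R t ht)) hBt

theorem shiftedCost_le (h : BoundedData T lamA lamB lamQ lamH lamR A B Q H R)
    (hc : CoerciveCost T γR γQ lamQ Q H R QT) (ht : t ∈ Icc 0 T) :
    shiftedCost Q H R t ≤ lamQ • 1 := by
  have hHRH := transpose_mul_mul_nonneg (hc.posDef_R ht).inv.posSemidef.nonneg (H t)
  have hQ : 0 ≤ Q t :=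
    (sub_add_cancel (Q t) _).subst (add_nonneg (hc.zero_le_shiftedCost ht) hHRH)
  exact (sub_le_self _ hHRH).trans
    ((norm_le_iff_le_smul_one hQ h.lamQ_pos.le).1 (h.norm_Q_le t ht))

end BoundedData

end Coefficients

section UniformBounds

variable {n m : ℕ} {T σ lamA lamB lamQ lamH lamR γR γQ α₀ α₁ t b : ℝ}
  {A : ℝ → Matrix (Fin n) (Fin n) ℝ} {B : ℝ → Matrix (Fin n) (Fin m) ℝ}
  {Q : ℝ → Matrix (Fin n) (Fin n) ℝ} {H : ℝ → Matrix (Fin m) (Fin n) ℝ}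
  {R : ℝ → Matrix (Fin m) (Fin m) ℝ} {QT : Matrix (Fin n) (Fin n) ℝ}
  {S : ℝ → Matrix (Fin n) (Fin n) ℝ}

namespace BoundedData

theorem growthRate_pos (h : BoundedData T lamA lamB lamQ lamH lamR A B Q H R)
    (hc : CoerciveCost T γR γQ lamQ Q H R QT) : 0 < growthRate lamA lamB lamH γR :=
  add_pos h.lamA_pos (div_pos (mul_pos h.lamB_pos h.lamH_pos) hc.γR_pos)

theorem smul_one_le_gramian_shiftedDrift (h : BoundedData T lamA lamB lamQ lamH lamR A B Q H R)
    (hc : CoerciveCost T γR γQ lamQ Q H R QT) (hα₀ : 0 < α₀) (hα₁ : 0 ≤ α₁) (ht : 0 ≤ t)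
    (htb : t ≤ b) (hb : b ≤ T) (hbσ : b - t ≤ σ) (hW₀ : α₀ • 1 ≤ gramian A B t b)
    (hW₁ : gramian A B t b ≤ α₁ • 1) :
    shiftedAlpha₀ lamA lamH γR α₀ α₁ σ • 1 ≤ gramian (shiftedDrift A B H R) B t b :=
  have hsub := Icc_subset_Icc ht hb
  (smul_one_le_smul_one (shiftedAlpha₀_le h.lamA_pos hα₀ (sub_nonneg.2 htb) hbσ)).trans
    (inv_smul_one_le_gramian_feedback h.continuousOn_A h.continuousOn_B
      (h.continuousOn_inv_mul_H hc) ht htb hb h.lamA_pos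
      (fun r hr => h.norm_A_le r (hsub hr)) (fun _ hr => h.norm_inv_mul_H_le hc (hsub hr))
      hα₀ hα₁ hW₀ hW₁)

theorem gramian_shiftedDrift_le (h : BoundedData T lamA lamB lamQ lamH lamR A B Q H R)
    (hc : CoerciveCost T γR γQ lamQ Q H R QT) (ht : 0 ≤ t) (htb : t ≤ b) (hb : b ≤ T)
    (hbσ : b - t ≤ σ) :
    gramian (shiftedDrift A B H R) B t b ≤ shiftedAlpha₁ lamA lamB lamH γR σ • 1 := by
  have hsub := Icc_subset_Icc ht hb
  have hμ := h.growthRate_pos hc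
  refine (gramian_le (h.continuousOn_shiftedDrift hc) h.continuousOn_B ht htb hb hμ
    (fun _ hr => h.norm_shiftedDrift_le hc (hsub hr)) fun r hr => h.norm_B_le r (hsub hr)).trans ?_
  rw [shiftedAlpha₁_eq_growthIntegral]
  have := growthIntegral_mono hμ hbσ
  exact smul_one_le_smul_one (by gcongr)

theorem le_riccatiUpper_of_window (h : BoundedData T lamA lamB lamQ lamH lamR A B Q H R)
    (hc : CoerciveCost T γR γQ lamQ Q H R QT)
    (hS : IsSymmRiccatiSolution (shiftedDrift A B H R) (controlWeight B R) (shiftedCost Q H R)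
      S 0 T)
    (hσ : 0 < σ) (hα₀ : 0 < α₀) (hα₁ : 0 ≤ α₁) (ht : 0 ≤ t) (htb : t ≤ b) (hb : b ≤ T)
    (hbσ : b - t ≤ σ) (hW₀ : α₀ • 1 ≤ gramian A B t b) (hW₁ : gramian A B t b ≤ α₁ • 1) :
    S t ≤ riccatiUpper lamA lamB lamQ lamH lamR γR α₀ α₁ σ • 1 :=
  have hsub := Icc_subset_Icc ht hb
  have hμ := h.growthRate_pos hc
  ((hS.mono ht hb).le_of_gramian_bounds (h.continuousOn_shiftedDrift hc) h.continuousOn_B ht htb hb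
    hμ (fun _ hr => h.norm_shiftedDrift_le hc (hsub hr)) (fun r hr => h.norm_B_le r (hsub hr))
    (fun _ hr => hc.posDef_R (hsub hr)) h.lamR_pos.le (fun _ hr => h.R_le hc (hsub hr))
    h.lamQ_pos.le (fun _ hr => h.shiftedCost_le hc (hsub hr))
    (shiftedAlpha₀_pos h.lamA_pos hα₀ hσ) (shiftedAlpha₁_pos h.lamB_pos hμ hσ).le
    (h.smul_one_le_gramian_shiftedDrift hc hα₀ hα₁ ht htb hb hbσ hW₀ hW₁)
    (h.gramian_shiftedDrift_le hc ht htb hb hbσ)).trans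
  (smul_one_le_smul_one (window_le_riccatiUpper h.lamA_pos h.lamB_pos hμ h.lamQ_pos.le h.lamR_pos.le
    hc.γR_pos hα₀ hσ hbσ))

theorem le_riccatiUpper_of_near_terminal (h : BoundedData T lamA lamB lamQ lamH lamR A B Q H R)
    (hc : CoerciveCost T γR γQ lamQ Q H R QT)
    (hS : IsSymmRiccatiSolution (shiftedDrift A B H R) (controlWeight B R) (shiftedCost Q H R)
      S 0 T)
    (hST : S T = QT) (ht : t ∈ Icc 0 T) (htσ : T - t ≤ σ) :
    S t ≤ riccatiUpper lamA lamB lamQ lamH lamR γR α₀ α₁ σ • 1 :=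
  (hS.le_of_terminal_le (h.continuousOn_shiftedDrift hc) (h.growthRate_pos hc)
    (fun _ => h.norm_shiftedDrift_le hc) (fun _ => hc.zero_le_controlWeight B) h.lamQ_pos.le
    (fun _ => h.shiftedCost_le hc) h.lamQ_pos.le (hST.trans_le hc.QT_le) ht).trans
  (smul_one_le_smul_one
    (terminal_le_riccatiUpper (h.growthRate_pos hc) h.lamQ_pos.le hc.γR_pos htσ))

theorem riccatiLower_le_of_window (h : BoundedData T lamA lamB lamQ lamH lamR A B Q H R)
    (hc : CoerciveCost T γR γQ lamQ Q H R QT)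
    (hS : IsSymmRiccatiSolution (shiftedDrift A B H R) (controlWeight B R) (shiftedCost Q H R)
      S 0 T)
    (hpos : ∀ r ∈ Icc 0 T, (S r).PosDef) (hσ : 0 < σ) (ht : 0 ≤ t) (htσ : t + σ ≤ T) :
    riccatiLower lamA lamB lamH γR γQ σ • 1 ≤ S t := by
  have hsub := Icc_subset_Icc ht htσ
  have hμ := h.growthRate_pos hc
  have hI := growthIntegral_pos hμ hσ
  have hγQ := hc.γQ_pos
  have hg := div_pos (pow_pos h.lamB_pos 2) hc.γR_pos
  have hd₀ := dualAlpha₀_pos hμ hσ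
  have hinv := (hS.mono ht htσ).inv_le_of_smul_one_le_cost (fun r hr => hpos r (hsub hr))
    (h.continuousOn_shiftedDrift hc) ht (lt_add_of_pos_right t hσ) htσ hμ
    (fun _ hr => h.norm_shiftedDrift_le hc (hsub hr)) hg.le
    (fun _ hr => h.controlWeight_le hc (hsub hr)) hγQ (fun r hr => hc.le_Q r (hsub hr))
  rw [add_sub_cancel_left, ← dualAlpha₀_eq_growthIntegral, ← dualAlpha₁_eq_growthIntegral] at hinv
  refine smul_one_le_of_inv_le_smul_one (hpos t ⟨ht, by linarith⟩) ?_
    (riccatiLower_le_inv_window h.lamB_pos hμ hc.γR_pos hγQ hσ) ?_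
  · have hd₁ := dualAlpha₁_pos hμ hσ
    positivity
  · rwa [← dualAlpha₁_eq_growthIntegral]

theorem riccatiLower_le_of_near_terminal (h : BoundedData T lamA lamB lamQ lamH lamR A B Q H R)
    (hc : CoerciveCost T γR γQ lamQ Q H R QT)
    (hS : IsSymmRiccatiSolution (shiftedDrift A B H R) (controlWeight B R) (shiftedCost Q H R)
      S 0 T)
    (hpos : ∀ r ∈ Icc 0 T, (S r).PosDef) (hST : S T = QT) (ht : t ∈ Icc 0 T) (htσ : T - t ≤ σ) :
    riccatiLower lamA lamB lamH γR γQ σ • 1 ≤ S t := by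
  have hμ := h.growthRate_pos hc
  have hI := growthIntegral_nonneg hμ (sub_nonneg.2 ht.2)
  have hγQ := hc.γQ_pos
  have hg := div_pos (pow_pos h.lamB_pos 2) hc.γR_pos
  exact smul_one_le_of_inv_le_smul_one (hpos t ht) (by positivity)
    (riccatiLower_le_inv_terminal hμ hc.γR_pos hγQ (sub_nonneg.2 ht.2) htσ)
    (hS.inv_le_of_le_terminal hpos (h.continuousOn_shiftedDrift hc) hμ
      (fun _ => h.norm_shiftedDrift_le hc) hg.le (fun _ => h.controlWeight_le hc)
      (fun _ => hc.zero_le_shiftedCost) hγQ (hc.le_QT.trans_eq hST.symm) ht)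

end BoundedData

end UniformBounds

theorem mainTheorem5_general {n m : ℕ} {T σ lamA lamB lamQ lamH lamR γR γQ α₀ α₁ : ℝ}
    {A : ℝ → Matrix (Fin n) (Fin n) ℝ} {B : ℝ → Matrix (Fin n) (Fin m) ℝ}
    {Q : ℝ → Matrix (Fin n) (Fin n) ℝ} {H : ℝ → Matrix (Fin m) (Fin n) ℝ}
    {R : ℝ → Matrix (Fin m) (Fin m) ℝ} {QT : Matrix (Fin n) (Fin n) ℝ} (hT : 0 ≤ T) (hσ : 0 < σ)
    (hbdd : BoundedData T lamA lamB lamQ lamH lamR A B Q H R) (hα₀ : 0 < α₀) (hα₁ : 0 ≤ α₁)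
    (hctrl : ∀ t₀ ∈ Icc 0 (T - σ), ∃ t₁ ∈ Icc t₀ (t₀ + σ),
      α₀ • 1 ≤ gramian A B t₀ t₁ ∧ gramian A B t₀ t₁ ≤ α₁ • 1)
    (hcoer : CoerciveCost T γR γQ lamQ Q H R QT) :
    0 < riccatiLower lamA lamB lamH γR γQ σ ∧
    0 < riccatiUpper lamA lamB lamQ lamH lamR γR α₀ α₁ σ ∧
    ∃ S : ℝ → Matrix (Fin n) (Fin n) ℝ,
      IsRiccatiSolution T A B Q H R QT S ∧
      (∀ S' : ℝ → Matrix (Fin n) (Fin n) ℝ,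
        IsRiccatiSolution T A B Q H R QT S' → EqOn S' S (Icc 0 T)) ∧
      ∀ t ∈ Icc 0 T,
        riccatiLower lamA lamB lamH γR γQ σ • (1 : Matrix (Fin n) (Fin n) ℝ) ≤ S t ∧
        S t ≤ riccatiUpper lamA lamB lamQ lamH lamR γR α₀ α₁ σ •
          (1 : Matrix (Fin n) (Fin n) ℝ) := by
  have hμ := hbdd.growthRate_pos hcoer
  have hF := hbdd.continuousOn_shiftedDrift hcoer
  have hG := hbdd.continuousOn_controlWeight hcoer
  obtain ⟨S, hS, hST, hpos⟩ := exists_posDef_isSymmRiccatiSolution hT hF hG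
    (hbdd.continuousOn_shiftedCost hcoer) (fun _ => hcoer.zero_le_controlWeight B)
    (fun _ => hcoer.zero_le_shiftedCost) (posDef_of_smul_one_le hcoer.γQ_pos hcoer.le_QT)
  have hSc : ContinuousOn S (Icc 0 T) := fun t ht => (hS.hasDerivWithinAt t ht).continuousWithinAt
  have hS' := fun t (ht : t ∈ Ico 0 T) => hS.hasDerivWithinAt t (Ico_subset_Icc_self ht)
  refine ⟨riccatiLower_pos hbdd.lamB_pos hμ hcoer.γR_pos hcoer.γQ_pos hσ,
    riccatiUpper_pos hμ hbdd.lamQ_pos hcoer.γR_pos, S, isRiccatiSolution_iff.2 ⟨hSc, hS', hST⟩,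
    fun X hX => ?_, fun t ht => ?_⟩
  · obtain ⟨hXc, hX', hXT⟩ := isRiccatiSolution_iff.1 hX
    exact eqOn_of_hasDerivWithinAt_riccatiField hF hG hXc hSc hX' hS' (hXT.trans hST.symm)
  · rcases le_total t (T - σ) with hwindow | hterminal
    · obtain ⟨b, ⟨htb, hbσ⟩, hW₀, hW₁⟩ := hctrl t ⟨ht.1, hwindow⟩
      exact ⟨hbdd.riccatiLower_le_of_window hcoer hS hpos hσ ht.1 (by linarith),
        hbdd.le_riccatiUpper_of_window hcoer hS hσ hα₀ hα₁ ht.1 htb (by linarith) (by linarith)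
          hW₀ hW₁⟩
    · exact ⟨hbdd.riccatiLower_le_of_near_terminal hcoer hS hpos hST ht (by linarith),
        hbdd.le_riccatiUpper_of_near_terminal hcoer hS hST ht (by linarith)⟩

theorem mainTheorem5 (n m : ℕ) (T σ : ℝ)
    (lamA lamB lamQ lamH lamR γR γQ α₀ α₁ β₀ β₁ : ℝ)
    (A : ℝ → Matrix (Fin n) (Fin n) ℝ) (B : ℝ → Matrix (Fin n) (Fin m) ℝ)
    (Q : ℝ → Matrix (Fin n) (Fin n) ℝ) (H : ℝ → Matrix (Fin m) (Fin n) ℝ)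
    (R : ℝ → Matrix (Fin m) (Fin m) ℝ) (QT : Matrix (Fin n) (Fin n) ℝ)
    (hbdd : BoundedData T lamA lamB lamQ lamH lamR A B Q H R)
    (hucc : UniformlyCompletelyControllable T σ α₀ α₁ β₀ β₁ A B)
    (hcoer : CoerciveCost T γR γQ lamQ Q H R QT) :
    0 < riccatiLower lamA lamB lamH γR γQ σ ∧
    0 < riccatiUpper lamA lamB lamQ lamH lamR γR α₀ α₁ σ ∧
    ∃ S : ℝ → Matrix (Fin n) (Fin n) ℝ,
      IsRiccatiSolution T A B Q H R QT S ∧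
      (∀ S' : ℝ → Matrix (Fin n) (Fin n) ℝ,
        IsRiccatiSolution T A B Q H R QT S' → EqOn S' S (Icc 0 T)) ∧
      ∀ t ∈ Icc 0 T,
        riccatiLower lamA lamB lamH γR γQ σ • (1 : Matrix (Fin n) (Fin n) ℝ) ≤ S t ∧
        S t ≤ riccatiUpper lamA lamB lamQ lamH lamR γR α₀ α₁ σ •
          (1 : Matrix (Fin n) (Fin n) ℝ) :=
  mainTheorem5_general (hucc.σ_mem.1.trans hucc.σ_mem.2).le hucc.σ_mem.1 hbdd hucc.α₀_pos
    hucc.α₁_pos.le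
    (fun t ht => (hucc.bounds t ht).imp fun _ h => ⟨h.1, h.2.1, h.2.2.1⟩) hcoer
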